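/- **Notation.** For complex $\xi\neq 0$ and $q$ with $|q|<1$, $|\xi q|<1$ put $$F_1(\xi;q):=\prod_{n\ge1}(1-\xi q^n),\qquad F_2(\xi;q):=\prod_{n\ge1}\bigl(1-(\xi q)^n\bigr),\qquad F_3(\xi;q):=\prod_{n\ge1}\bigl(1-\xi^{-1}(\xi q)^n\bigr).$$ Let $\Phi(z,s,a):=\sum_{n\ge0}\frac{z^n}{(n+a)^s}$ be Lerch's transcendent. For $x\in\mathbb R$ let $((x)):=x-\lfloor x\rfloor-\tfrac12$ if $x\notin\mathbb Z$ and $((x)):=0$ if $x\in\mathbb Z$. For coprime integers $m,n$ with $n\geq 1$ let $\omega_{m,n}:=\exp(\pi i\,s(m,n))$, where $s(m,n):=\sum_{\mu=0}^{n-1}\left(\left(\frac{\mu}{n}\right)\right)\left(\left(\frac{m\mu}{n}\right)\right)$. For integers $t,b,k\ge1$, $h\ge 0$ and $a\in\mathbb Z$ let $$\lambda_{t,a,b,h,k}:=\gcd(k,t)\cdot\begin{cases}1&\text{if }k=1\text{ or }\bigl(k>1\text{ and }b\nmid\frac{k}{\gcd(k,t)}\bigr),\\ b&\text{if } k>1,\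 b\mid\frac{k}{\gcd(k,t)}\text{ and }\frac{ht}{\gcd(k,t)}+a\frac{k}{b\gcd(k,t)}\not\equiv0\pmod b,\\ b^2&\text{if } k>1,\ b\mid\frac{k}{\gcd(k,t)}\text{ and }\frac{ht}{\gcd(k,t)}+a\frac{k}{b\gcd(k,t)}\equiv0\pmod b.\end{cases}$$ For $0\le\theta<\frac\pi2$ let $D_\theta:=\{re^{i\alpha}: r\ge0,\ |\alpha|\le\theta\}$. All complex powers and square roots are principal branches; $z\to0$ in $D_\theta$ is always through $z\ne0$, and implied constants may depend on $\theta$ and the other fixed parameters. **Theorem 2.1.** Let $b\ge1$ be an integer, let $\xi$ be a primitive $b$-th root of unity, and let $0\le\theta<\frac\pi2$. (1) If $b\ge2$, then as $z\to0$ in $D_\theta$, $$F_1\left(\xi;e^{-z}\right)=\frac{1}{\sqrt{1-\xi}}\,e^{-\frac{\xi\Phi(\xi,2,1)}{z}}\bigl(1+O(|z|)\bigr).$$ (2) Suppose that $b$ is an odd prime and $\xi=e^{2\pi i a/b}$ with $a\in\mathbb Z$ (so $b\nmid a$). Let $t,k\ge1$ and $0\le h<k$ be integers with $\gcd(h,k)=1$,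 write $\lambda:=\lambda_{t,a,b,h,k}$, and let $q=e^{\frac{2\pi i}{k}(h+iz)}$. Then as $z\to0$ in $D_\theta$, $$F_2\left(\xi;q^t\right)\sim\omega^{-1}_{\frac{hbt+ak}{\lambda},\frac{kb}{\lambda}}\left(\frac{\lambda}{tbz}\right)^{\frac12}e^{-\frac{\pi\lambda^2}{12b^2ktz}},$$ meaning that the quotient of the two sides tends to $1$. (3) As $z\to0$ in $D_\theta$, $$F_3\left(\xi;e^{-z}\right)=\frac{\sqrt{2\pi}\,(b^2z)^{\frac12-\frac1b}}{\Gamma\left(\frac1b\right)}\prod_{j=1}^{b-1}\frac{1}{(1-\xi^j)^{\frac jb}}\;e^{-\frac{\pi^2}{6b^2z}}\bigl(1+O(|z|)\bigr).$$ -/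

import Mathlib

open Filter Topology Asymptotics

noncomputable section

namespace QProducts

/-- `F₁(ξ; q) = ∏_{n ≥ 1} (1 - ξ q^n)`. -/
def F1 (ξ q : ℂ) : ℂ := ∏' n : ℕ, (1 - ξ * q ^ (n + 1))

/-- `F₂(ξ; q) = ∏_{n ≥ 1} (1 - (ξ q)^n)`. -/
def F2 (ξ q : ℂ) : ℂ := ∏' n : ℕ, (1 - (ξ * q) ^ (n + 1))

/-- `F₃(ξ; q) = ∏_{n ≥ 1} (1 - ξ⁻¹ (ξ q)^n)`. -/
def F3 (ξ q : ℂ) : ℂ := ∏' n : ℕ, (1 - ξ⁻¹ * (ξ * q) ^ (n + 1))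

/-- The products above converge (absolutely) inside the unit disc. -/
theorem multipliable_one_sub_mul_pow (c x : ℂ) (hx : ‖x‖ < 1) :
    Multipliable fun n : ℕ => 1 - c * x ^ (n + 1) := by
  have hs : Summable fun n : ℕ => ‖-(c * x ^ (n + 1))‖ := by
    have h1 : Summable fun n : ℕ => ‖x‖ ^ n := summable_geometric_of_lt_one (norm_nonneg x) hx
    have h2 := (h1.mul_left (‖c‖ * ‖x‖))
    refine h2.congr fun n => ?_
    rw [norm_neg, norm_mul, norm_pow, pow_succ]
    ring
  simpa only [sub_eq_add_neg] using multipliable_one_add_of_summable hs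

/-- Lerch's transcendent `Φ(z, s, a) = ∑_{n ≥ 0} z^n / (n + a)^s`. -/
def lerchPhi (z s a : ℂ) : ℂ := ∑' n : ℕ, z ^ n / ((n : ℂ) + a) ^ s

/-- The series `Φ(ξ, 2, 1)` converges (absolutely) for `|ξ| ≤ 1`. -/
theorem summable_lerchPhi_two_one (ξ : ℂ) (hξ : ‖ξ‖ ≤ 1) :
    Summable fun n : ℕ => ξ ^ n / ((n : ℂ) + 1) ^ (2 : ℂ) := by
  have h1 : Summable fun n : ℕ => 1 / ((n + 1 : ℕ) : ℝ) ^ 2 :=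
    (summable_nat_add_iff 1).2 (Real.summable_one_div_nat_pow.2 (by norm_num))
  refine Summable.of_norm_bounded h1 fun n => ?_
  have h2 : ((n : ℂ) + 1) ^ (2 : ℂ) = ((n : ℂ) + 1) ^ 2 := by
    exact_mod_cast Complex.cpow_natCast ((n : ℂ) + 1) 2
  have h3 : ‖(n : ℂ) + 1‖ = ((n + 1 : ℕ) : ℝ) := by
    rw [← Complex.norm_natCast (n + 1)]
    push_cast
    rfl
  rw [h2, norm_div, norm_pow, norm_pow, h3]
  exact div_le_div_of_nonneg_right (pow_le_one₀ (norm_nonneg ξ) hξ) (by positivity)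

/-- The sawtooth function `((x))`: it is `0` at integers and `x - ⌊x⌋ - 1/2` elsewhere
(`Int.fract x = x - ⌊x⌋`, which vanishes exactly at the integers). -/
def sawtooth (x : ℝ) : ℝ := if Int.fract x = 0 then 0 else Int.fract x - 1 / 2

/-- The Dedekind sum `s(h, k) = ∑_{μ mod k} ((μ / k)) ((h μ / k))`. -/
def dedekindSum (h : ℤ) (k : ℕ) : ℝ :=
  ∑ μ ∈ Finset.range k, sawtooth ((μ : ℝ) / k) * sawtooth ((h : ℝ) * μ / k)

/-- The multiplier `ω_{m,n} = exp (π i s(m / g, n / g))` with `g = gcd(m, n)`; for coprime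
`m`, `n` this is `exp (π i s(m, n))`. -/
def etaOmega (m : ℤ) (n : ℕ) : ℂ :=
  Complex.exp (Real.pi * Complex.I *
    (dedekindSum (m / (Int.gcd m n : ℤ)) (n / Int.gcd m n) : ℂ))

/-- The number `λ_{t,a,b,h,k}`. The divisions by `gcd(k, t)` are exact, and so is the division by
`b * gcd(k, t)` in the two cases with `b ∣ k / gcd(k, t)`, the only ones in which it matters. -/
def lam (t : ℕ) (a : ℤ) (b h k : ℕ) : ℕ :=
  Nat.gcd k t *
    if k = 1 ∨ (1 < k ∧ ¬ b ∣ k / Nat.gcd k t) then 1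
    else if ¬ ((h : ℤ) * ((t / Nat.gcd k t : ℕ) : ℤ) +
        a * ((k / (b * Nat.gcd k t) : ℕ) : ℤ) ≡ 0 [ZMOD (b : ℤ)]) then b
    else b ^ 2

/-- The closed cone `D_θ = {r e^{iα} : r ≥ 0, |α| ≤ θ}`. -/
def cone (θ : ℝ) : Set ℂ :=
  {z | ∃ r α : ℝ, 0 ≤ r ∧ |α| ≤ θ ∧ z = (r : ℂ) * Complex.exp (Complex.I * (α : ℂ))}

/-- The filter of `z → 0`, `z ≠ 0`, inside the cone `D_θ`. -/
def toZeroIn (θ : ℝ) : Filter ℂ := 𝓝[cone θ \ {0}] 0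

/-- `f(z) = g(z) (1 + O(|z|))` along the filter `l`. -/
def EqOneAddBigO (l : Filter ℂ) (f g : ℂ → ℂ) : Prop :=
  ∃ E : ℂ → ℂ, E =O[l] (fun z => ‖z‖) ∧ ∀ᶠ z in l, f z = g z * (1 + E z)

end QProducts

end

/-! Everything reduces to the one-class products `expProd ζ x w` = ∏_{m ≥ 0} (1 - ζ e^{-(m+x)w})
with |ζ| = 1 and 0 < x ≤ 1. The logarithm of such a product sums f((m+x)w) for f(u) = log(1 - ζ
e^{-u}), whose antiderivative is Li₂(ζ e^{-u}). Euler–Maclaurin summation in the sector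
(`norm_sum_sub_le`) gives, for ζ ≠ 1, exp(-Li₂(ζ)/w + (1/2 - x) log(1 - ζ)) (1 + O(|w|)). For ζ = 1
the function f is singular at 0, so log u is subtracted first. Stirling's formula restores the
product of the (m+x)w and contributes √(2π)/Γ(x). F₁ is one such product. For F₂ and F₃ the
coefficients are periodic modulo the order N of a root of unity, so each is a product of N of them
with w replaced by Nw. The constants are then evaluated by `sum_dilog_pow` (Li₂ over all N-th roots
of unity), `sum_log_one_sub_pow` (∏(1 - ζ^j) = N) and `sum_mul_log_one_sub_pow` (weighted logarithms
give a Dedekind sum). For F₂ at a general cusp, `lam_eq_gcd` shows that λ is the factor needed to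
reduce (hbt + ak)/(kb) to lowest terms, so N = kb/λ. -/

namespace QProducts

open scoped ComplexConjugate

/-! ### Euler–Maclaurin summation in a sector -/

/-- A three-point quadrature rule on `[0, 1]` which is exact for affine functions. -/
theorem norm_quadrature_le {G g g' g'' : ℝ → ℂ} {K x : ℝ}
    (hG : ∀ s ∈ Set.Icc (0 : ℝ) 1, HasDerivAt G (g s) s)
    (hg : ∀ s ∈ Set.Icc (0 : ℝ) 1, HasDerivAt g (g' s) s)
    (hg' : ∀ s ∈ Set.Icc (0 : ℝ) 1, HasDerivAt g' (g'' s) s)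
    (hK : ∀ s ∈ Set.Icc (0 : ℝ) 1, ‖g'' s‖ ≤ K) (hx : x ∈ Set.Icc (0 : ℝ) 1) :
    ‖G 1 - G 0 - g x - (1 / 2 - x) * (g 1 - g 0)‖ ≤ 3 * K := by
  have hK0 : 0 ≤ K := (norm_nonneg _).trans (hK 0 (by simp))
  have key : ∀ p p' : ℝ → ℂ, (∀ s ∈ Set.Icc (0 : ℝ) 1, HasDerivAt p (p' s) s) →
      (∀ s ∈ Set.Icc (0 : ℝ) 1, ‖p' s‖ ≤ K) → ∀ s ∈ Set.Icc (0 : ℝ) 1, ‖p s - p 0‖ ≤ K := by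
    intro p p' hp hp' s hs
    have := norm_image_sub_le_of_norm_deriv_le_segment'
      (fun t ht => (hp t ht).hasDerivWithinAt) (fun t ht => hp' t ⟨ht.1, ht.2.le⟩) s hs
    refine this.trans ?_
    nlinarith [hs.1, hs.2]
  -- Subtracting Taylor polynomials at 0 from g', g and G in turn leaves remainders of size at most
  -- K. The rule annihilates affine g, so its error combines three such remainders with weights 1, 1
  -- and |1/2 - x| ≤ 1.
  have h1 := key g' g'' hg' hK
  have h2 := key (fun s => g s - s * g' 0) (fun s => g' s - g' 0) (fun s hs => by
    have h : HasDerivAt (fun s : ℝ => (s : ℂ) * g' 0) (1 * g' 0) s :=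
      (Complex.ofRealCLM.hasDerivAt (x := s)).mul_const _
    exact ((hg s hs).fun_sub h).congr_deriv (by ring)) h1
  have h3 := key (fun s => G s - s * g 0 - (s : ℂ) ^ 2 * (g' 0 / 2))
    (fun s => g s - s * g' 0 - g 0) (fun s hs => by
      have e : HasDerivAt (fun s : ℝ => (s : ℂ)) 1 s := Complex.ofRealCLM.hasDerivAt (x := s)
      exact (((hG s hs).fun_sub (e.mul_const (g 0))).fun_sub
        ((e.fun_pow 2).mul_const (g' 0 / 2))).congr_deriv (by push_cast; ring))
    (fun s hs => by simpa using h2 s hs)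
  have a1 := h3 1 (by simp)
  have a2 := h2 x hx
  have a3 := h2 1 (by simp)
  have e : G 1 - G 0 - g x - (1 / 2 - x) * (g 1 - g 0) =
      ((G 1 - ((1 : ℝ) : ℂ) * g 0 - ((1 : ℝ) : ℂ) ^ 2 * (g' 0 / 2)) -
        (G 0 - ((0 : ℝ) : ℂ) * g 0 - ((0 : ℝ) : ℂ) ^ 2 * (g' 0 / 2))) -
      ((g x - x * g' 0) - (g 0 - ((0 : ℝ) : ℂ) * g' 0)) -
      ((1 / 2 - x : ℝ) : ℂ) *
        ((g 1 - ((1 : ℝ) : ℂ) * g' 0) - (g 0 - ((0 : ℝ) : ℂ) * g' 0)) := by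
    push_cast
    ring
  rw [e]
  refine (norm_sub_le _ _).trans ?_
  have h4 := norm_sub_le
    ((G 1 - ((1 : ℝ) : ℂ) * g 0 - ((1 : ℝ) : ℂ) ^ 2 * (g' 0 / 2)) -
        (G 0 - ((0 : ℝ) : ℂ) * g 0 - ((0 : ℝ) : ℂ) ^ 2 * (g' 0 / 2)))
    ((g x - x * g' 0) - (g 0 - ((0 : ℝ) : ℂ) * g' 0))
  have h5 : ‖((1 / 2 - x : ℝ) : ℂ)‖ ≤ 1 := by
    rw [Complex.norm_real, Real.norm_eq_abs, abs_le]
    constructor <;> linarith [hx.1, hx.2]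
  have h6 := mul_le_mul h5 a3 (norm_nonneg _) zero_le_one
  rw [norm_mul]
  linarith

/-- Euler–Maclaurin summation along a ray of a sector, with the end point `0` excluded. -/
theorem norm_sum_quadrature_le {κ C : ℝ} {F f f' f'' : ℂ → ℂ}
    (hF : ∀ u : ℂ, 0 < u.re → HasDerivAt F (f u) u)
    (hf : ∀ u : ℂ, 0 < u.re → HasDerivAt f (f' u) u)
    (hf' : ∀ u : ℂ, 0 < u.re → HasDerivAt f' (f'' u) u)
    (hC : ∀ u : ℂ, 0 < u.re → κ * ‖u‖ ≤ u.re → ‖f'' u‖ ≤ C / (1 + ‖u‖) ^ 2)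
    {w : ℂ} (hw : 0 < w.re) (hwκ : κ * ‖w‖ ≤ w.re) (hw1 : ‖w‖ ≤ 1)
    {x : ℝ} (hx : x ∈ Set.Icc (0 : ℝ) 1) {ε : ℝ} (hε : 0 < ε) (M : ℕ) :
    ‖F (((M + ε : ℝ) : ℂ) * w) - F ((ε : ℂ) * w) -
        w * ∑ m ∈ Finset.range M, f (((m + ε + x : ℝ) : ℂ) * w) -
        (1 / 2 - x) * w * (f (((M + ε : ℝ) : ℂ) * w) - f ((ε : ℂ) * w))‖ ≤
      6 * C * ‖w‖ ^ 2 * (1 / (1 + ε * ‖w‖) - 1 / (1 + (M + ε) * ‖w‖)) := by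
  have hC0 : 0 ≤ C := by
    have := (norm_nonneg _).trans (hC w hw hwκ)
    by_contra! h
    exact absurd this (not_le.2 (div_neg_of_neg_of_pos h (by positivity)))
  have hr : 0 < ‖w‖ := norm_pos_iff.2 (by rintro rfl; simp at hw)
  induction M with
  | zero => simp
  | succ M ih =>
    set p : ℝ := M + ε with hp
    have hp0 : 0 < p := by positivity
    have hre : ∀ s ∈ Set.Icc (0 : ℝ) 1, 0 < (((p + s : ℝ) : ℂ) * w).re := fun s hs => by
      rw [Complex.re_ofReal_mul]
      exact mul_pos (by linarith [hs.1]) hw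
    have hline : ∀ s : ℝ, HasDerivAt (fun s : ℝ => ((p + s : ℝ) : ℂ) * w) w s := fun s => by
      have e : HasDerivAt (fun s : ℝ => (s : ℂ)) 1 s := Complex.ofRealCLM.hasDerivAt (x := s)
      simpa using (e.const_add (p : ℂ)).mul_const w
    have hseg := norm_quadrature_le (G := fun s => F (((p + s : ℝ) : ℂ) * w))
      (g := fun s => f (((p + s : ℝ) : ℂ) * w) * w)
      (g' := fun s => f' (((p + s : ℝ) : ℂ) * w) * w * w)
      (g'' := fun s => f'' (((p + s : ℝ) : ℂ) * w) * w * w * w)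
      (K := C / (1 + p * ‖w‖) ^ 2 * ‖w‖ ^ 3)
      (fun s hs => (hF _ (hre s hs)).comp s (hline s))
      (fun s hs => ((hf _ (hre s hs)).comp s (hline s)).mul_const w)
      (fun s hs => (((hf' _ (hre s hs)).comp s (hline s)).mul_const w).mul_const w)
      (fun s hs => by
        have hps : 0 < p + s := by linarith [hs.1]
        have hn : ‖((p + s : ℝ) : ℂ) * w‖ = (p + s) * ‖w‖ := by
          rw [norm_mul, Complex.norm_real, Real.norm_of_nonneg hps.le]
        have h1 := hC _ (hre s hs) (by
          rw [hn, Complex.re_ofReal_mul]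
          nlinarith)
        rw [norm_mul, norm_mul, norm_mul, mul_assoc, mul_assoc, ← pow_two, ← pow_succ']
        refine mul_le_mul_of_nonneg_right (h1.trans ?_) (by positivity)
        rw [hn]
        gcongr
        linarith [hs.1]) hx
    -- The error of one step is dominated by a telescoping difference, which makes the total uniform
    -- in M. The extra factor 2 is 1 + (p+1)‖w‖ ≤ 2(1 + p‖w‖), valid because ‖w‖ ≤ 1.
    have hb : 3 * (C / (1 + p * ‖w‖) ^ 2 * ‖w‖ ^ 3) ≤
        6 * C * ‖w‖ ^ 2 * (1 / (1 + p * ‖w‖) - 1 / (1 + (p + 1) * ‖w‖)) := by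
      have hA : 0 < 1 + p * ‖w‖ := by positivity
      have hB : 0 < 1 + (p + 1) * ‖w‖ := by positivity
      have e1 : 1 / (1 + p * ‖w‖) - 1 / (1 + (p + 1) * ‖w‖) =
          ‖w‖ / ((1 + p * ‖w‖) * (1 + (p + 1) * ‖w‖)) := by
        field_simp
        ring
      have e2 : ‖w‖ / (1 + p * ‖w‖) ^ 2 ≤
          2 * (‖w‖ / ((1 + p * ‖w‖) * (1 + (p + 1) * ‖w‖))) := by
        rw [← mul_div_assoc, div_le_div_iff₀ (by positivity) (by positivity)]
        have : 1 + (p + 1) * ‖w‖ ≤ 2 * (1 + p * ‖w‖) := by nlinarith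
        calc ‖w‖ * ((1 + p * ‖w‖) * (1 + (p + 1) * ‖w‖))
            ≤ ‖w‖ * ((1 + p * ‖w‖) * (2 * (1 + p * ‖w‖))) := by gcongr
          _ = _ := by ring
      rw [e1]
      calc 3 * (C / (1 + p * ‖w‖) ^ 2 * ‖w‖ ^ 3)
          = 3 * C * ‖w‖ ^ 2 * (‖w‖ / (1 + p * ‖w‖) ^ 2) := by ring
        _ ≤ 3 * C * ‖w‖ ^ 2 * (2 * (‖w‖ / ((1 + p * ‖w‖) * (1 + (p + 1) * ‖w‖)))) := by
            gcongr
        _ = _ := by ring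
    have ep : ((M + 1 : ℕ) : ℝ) + ε = p + 1 := by push_cast; rw [hp]; ring
    rw [ep, Finset.sum_range_succ, ← hp]
    simp only [add_zero] at hseg
    have := (norm_add_le _ _).trans (add_le_add ih (hseg.trans hb))
    refine le_trans (le_of_eq ?_) (this.trans (le_of_eq ?_))
    · congr 1
      ring
    · ring

/-- Euler–Maclaurin summation along a ray of a sector. -/
theorem norm_sum_sub_le {κ C : ℝ} {F f f' f'' : ℂ → ℂ}
    (hF : ∀ u : ℂ, 0 < u.re → HasDerivAt F (f u) u)
    (hf : ∀ u : ℂ, 0 < u.re → HasDerivAt f (f' u) u)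
    (hf' : ∀ u : ℂ, 0 < u.re → HasDerivAt f' (f'' u) u)
    (hC : ∀ u : ℂ, 0 < u.re → κ * ‖u‖ ≤ u.re → ‖f'' u‖ ≤ C / (1 + ‖u‖) ^ 2)
    {w : ℂ} (hw : 0 < w.re) (hwκ : κ * ‖w‖ ≤ w.re) (hw1 : ‖w‖ ≤ 1)
    {x : ℝ} (hx0 : 0 < x) (hx1 : x ≤ 1) {F₀ f₀ : ℂ}
    (hF₀ : Tendsto (fun ε : ℝ => F ((ε : ℂ) * w)) (𝓝[>] 0) (𝓝 F₀))
    (hf₀ : Tendsto (fun ε : ℝ => f ((ε : ℂ) * w)) (𝓝[>] 0) (𝓝 f₀)) {M : ℕ} (hM : 0 < M) :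
    ‖∑ m ∈ Finset.range M, f (((m + x : ℝ) : ℂ) * w) -
        ((F (M * w) - F₀) / w - (1 / 2 - x) * (f (M * w) - f₀))‖ ≤ 6 * C * ‖w‖ := by
  have hr : 0 < ‖w‖ := norm_pos_iff.2 (by rintro rfl; simp at hw)
  have hw0 : w ≠ 0 := norm_pos_iff.1 hr
  have hC0 : 0 ≤ C := by
    have := (norm_nonneg _).trans (hC w hw hwκ)
    by_contra! h
    exact absurd this (not_le.2 (div_neg_of_neg_of_pos h (by positivity)))
  have hcont : ∀ (g : ℂ → ℂ) (g' : ℂ → ℂ) (_ : ∀ u : ℂ, 0 < u.re → HasDerivAt g (g' u) u)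
      (p q : ℝ) (_ : 0 < p + q),
      Tendsto (fun ε : ℝ => g (((p + ε + q : ℝ) : ℂ) * w)) (𝓝[>] 0)
        (𝓝 (g (((p + q : ℝ) : ℂ) * w))) := by
    intro g g' hg p q hpq
    have h1 : ContinuousAt g (((p + q : ℝ) : ℂ) * w) :=
      (hg _ (by rw [Complex.re_ofReal_mul]; exact mul_pos hpq hw)).continuousAt
    refine h1.tendsto.comp (tendsto_nhdsWithin_of_tendsto_nhds ?_)
    have : Continuous fun ε : ℝ => ((p + ε + q : ℝ) : ℂ) * w := by fun_prop
    simpa using this.tendsto 0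
  have hM' : (0 : ℝ) < (M : ℝ) + 0 := by simpa using hM
  -- Let ε → 0: the interior terms converge by continuity, the terms at the origin by `hF₀` and
  -- `hf₀`.
  have hlim := ((((hcont F f hF M 0 hM').sub hF₀).sub
    ((tendsto_finsetSum (Finset.range M) fun m _ => hcont f f' hf m x (by positivity)).const_mul
      w)).sub (((hcont f f' hf M 0 hM').sub hf₀).const_mul ((1 / 2 - x) * w))).norm
  have hle := le_of_tendsto hlim (b := 6 * C * ‖w‖ ^ 2) (by
    filter_upwards [self_mem_nhdsWithin] with ε hε
    have hε : 0 < ε := hε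
    simp only [add_zero]
    refine (norm_sum_quadrature_le hF hf hf' hC hw hwκ hw1 ⟨hx0.le, hx1⟩ hε M).trans ?_
    have h1 : 1 / (1 + ε * ‖w‖) ≤ 1 := by
      rw [div_le_one (by positivity)]
      linarith [mul_pos hε hr]
    have h2 : 0 ≤ 1 / (1 + (M + ε) * ‖w‖) := by positivity
    have h3 : 0 ≤ 6 * C * ‖w‖ ^ 2 := by positivity
    nlinarith)
  rw [← mul_le_mul_iff_right₀ hr, ← norm_mul]
  refine le_trans (le_of_eq ?_) (hle.trans (le_of_eq (by ring)))
  rw [← norm_neg]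
  congr 1
  simp only [add_zero, Complex.ofReal_natCast]
  field_simp
  ring

/-! ### The dilogarithm and the derivatives of log(1 - ζ e^{-u}) -/

/-- The dilogarithm `Li₂(y) = ∑_{n ≥ 1} y^n / n²` on the closed unit disc. -/
noncomputable def dilog (y : ℂ) : ℂ := ∑' n : ℕ, y ^ (n + 1) / ((n : ℂ) + 1) ^ 2

theorem norm_natCast_add_one (n : ℕ) : ‖(n : ℂ) + 1‖ = (n : ℝ) + 1 := by
  rw [← Nat.cast_succ, Complex.norm_natCast, Nat.cast_succ]

theorem summable_one_div_succ_sq : Summable fun n : ℕ => 1 / ((n : ℝ) + 1) ^ 2 := by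
  have h1 : Summable fun n : ℕ => 1 / ((n + 1 : ℕ) : ℝ) ^ 2 :=
    (summable_nat_add_iff 1).2 (Real.summable_one_div_nat_pow.2 (by norm_num))
  simpa using h1

theorem norm_dilog_term_le {y : ℂ} (hy : ‖y‖ ≤ 1) (n : ℕ) :
    ‖y ^ (n + 1) / ((n : ℂ) + 1) ^ 2‖ ≤ 1 / ((n : ℝ) + 1) ^ 2 := by
  rw [norm_div, norm_pow, norm_pow, norm_natCast_add_one]
  exact div_le_div_of_nonneg_right (pow_le_one₀ (norm_nonneg y) hy) (by positivity)

theorem summable_dilog {y : ℂ} (hy : ‖y‖ ≤ 1) :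
    Summable fun n : ℕ => y ^ (n + 1) / ((n : ℂ) + 1) ^ 2 :=
  Summable.of_norm_bounded summable_one_div_succ_sq (norm_dilog_term_le hy)

/-- Continuity up to the unit circle is needed because the end point u = 0 corresponds to y = ζ with
|ζ| = 1. -/
theorem continuousOn_dilog : ContinuousOn dilog (Metric.closedBall 0 1) := by
  refine continuousOn_tsum (fun n => ?_) summable_one_div_succ_sq
    fun n y hy => norm_dilog_term_le (by simpa using hy) n
  fun_prop

theorem dilog_zero : dilog 0 = 0 := by simp [dilog]

theorem dilog_one : dilog 1 = (Real.pi : ℂ) ^ 2 / 6 := by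
  have h := (hasSum_nat_add_iff' 1).2 hasSum_zeta_two
  have h2 := (Complex.hasSum_ofReal.2 h).tsum_eq
  simp only [Finset.range_one, Finset.sum_singleton, Nat.cast_zero] at h2
  rw [dilog]
  push_cast at h2
  simpa using h2

/-- The derivative stays a power series instead of -log(1 - y)/y, so y = 0 is not exceptional. -/
theorem hasDerivAt_dilog {y : ℂ} (hy : ‖y‖ < 1) :
    HasDerivAt dilog (∑' n : ℕ, y ^ n / ((n : ℂ) + 1)) y := by
  obtain ⟨ρ, hρ, hρ1⟩ := exists_between hy
  have hρ0 : 0 < ρ := (norm_nonneg y).trans_lt hρ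
  refine hasDerivAt_tsum_of_isPreconnected
    (g := fun (n : ℕ) (y : ℂ) => y ^ (n + 1) / ((n : ℂ) + 1) ^ 2)
    (g' := fun (n : ℕ) (y : ℂ) => y ^ n / ((n : ℂ) + 1)) (t := Metric.ball 0 ρ) (u := fun n => ρ ^ n)
    (summable_geometric_of_lt_one hρ0.le hρ1) Metric.isOpen_ball
    (convex_ball (0 : ℂ) ρ).isPreconnected (fun n z _ => ?_) (fun n z hz => ?_)
    (Metric.mem_ball_self hρ0) ?_ (by simpa using hρ)
  · have h0 : (n : ℂ) + 1 ≠ 0 := Nat.cast_add_one_ne_zero n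
    refine ((hasDerivAt_pow (n + 1) z).div_const (((n : ℂ) + 1) ^ 2)).congr_deriv ?_
    push_cast
    field_simp
  · rw [norm_div, norm_pow, norm_natCast_add_one]
    have hz : ‖z‖ ≤ ρ := by simpa using (Metric.mem_ball.1 hz).le
    calc ‖z‖ ^ n / ((n : ℝ) + 1) ≤ ‖z‖ ^ n / 1 := by
          gcongr
          linarith [Nat.cast_nonneg (α := ℝ) n]
      _ ≤ ρ ^ n := by
          rw [div_one]
          gcongr
  · simp

theorem norm_mul_exp_neg {ζ : ℂ} (hζ : ‖ζ‖ = 1) (u : ℂ) :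
    ‖ζ * Complex.exp (-u)‖ = Real.exp (-u.re) := by
  rw [norm_mul, hζ, one_mul, Complex.norm_exp, Complex.neg_re]

theorem norm_mul_exp_neg_lt {ζ u : ℂ} (hζ : ‖ζ‖ = 1) (hu : 0 < u.re) :
    ‖ζ * Complex.exp (-u)‖ < 1 := by
  rw [norm_mul_exp_neg hζ, Real.exp_lt_one_iff]
  linarith

theorem one_sub_mem_slitPlane {y : ℂ} (hy : ‖y‖ < 1) : 1 - y ∈ Complex.slitPlane := by
  refine Or.inl ?_
  rw [Complex.sub_re, Complex.one_re]
  linarith [(Complex.re_le_norm y)]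

theorem hasDerivAt_mul_exp_neg (ζ u : ℂ) :
    HasDerivAt (fun u => ζ * Complex.exp (-u)) (-(ζ * Complex.exp (-u))) u :=
  ((hasDerivAt_neg u).cexp.const_mul ζ).congr_deriv (by ring)

/-- Since y Li₂'(y) = -log(1 - y) and y = ζ e^{-u} has derivative -y, the signs cancel; this is the
antiderivative of the summand. -/
theorem hasDerivAt_dilog_mul_exp_neg {ζ u : ℂ} (hζ : ‖ζ‖ = 1) (hu : 0 < u.re) :
    HasDerivAt (fun u => dilog (ζ * Complex.exp (-u)))
      (Complex.log (1 - ζ * Complex.exp (-u))) u := by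
  have hy := norm_mul_exp_neg_lt hζ hu
  refine ((hasDerivAt_dilog hy).comp u (hasDerivAt_mul_exp_neg ζ u)).congr_deriv ?_
  have h := (Complex.hasSum_taylorSeries_neg_log' hy).tsum_eq
  rw [← neg_eq_iff_eq_neg.2 h, ← tsum_mul_right, ← tsum_neg]
  refine tsum_congr fun n => ?_
  ring

theorem hasDerivAt_log_one_sub {ζ u : ℂ} (hζ : ‖ζ‖ = 1) (hu : 0 < u.re) :
    HasDerivAt (fun u => Complex.log (1 - ζ * Complex.exp (-u)))
      (ζ * Complex.exp (-u) / (1 - ζ * Complex.exp (-u))) u := by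
  have hy := norm_mul_exp_neg_lt hζ hu
  exact (((hasDerivAt_mul_exp_neg ζ u).const_sub 1).clog (one_sub_mem_slitPlane hy)).congr_deriv
    (by ring)

theorem hasDerivAt_div_one_sub {ζ u : ℂ} (hζ : ‖ζ‖ = 1) (hu : 0 < u.re) :
    HasDerivAt (fun u => ζ * Complex.exp (-u) / (1 - ζ * Complex.exp (-u)))
      (-(ζ * Complex.exp (-u)) / (1 - ζ * Complex.exp (-u)) ^ 2) u := by
  have hy := Complex.slitPlane_ne_zero (one_sub_mem_slitPlane (norm_mul_exp_neg_lt hζ hu))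
  have h := hasDerivAt_mul_exp_neg ζ u
  exact (h.fun_div (h.const_sub 1) hy).congr_deriv (by ring)

/-! ### Decay of the second derivative in a sector -/

/-- Away from the pole at `u = 0` of the case `ζ = 1`, `1 - ζ e^{-u}` is bounded below in
a sector. -/
theorem exists_le_norm_one_sub {ζ : ℂ} (hζ : ‖ζ‖ = 1) (hζ1 : ζ ≠ 1) {κ : ℝ} (hκ : 0 < κ) :
    ∃ δ > 0, ∀ u : ℂ, 0 < u.re → κ * ‖u‖ ≤ u.re → δ ≤ ‖1 - ζ * Complex.exp (-u)‖ := by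
  have hd : 0 < ‖1 - ζ‖ := norm_pos_iff.2 (sub_ne_zero.2 hζ1.symm)
  have hd2 : ‖1 - ζ‖ ≤ 2 := by
    refine (norm_sub_le _ _).trans ?_
    rw [hζ, norm_one]
    norm_num
  -- For ‖u‖ ≤ η the perturbation is at most 2η, half of ‖1 - ζ‖ = 4η. For ‖u‖ ≥ η the sector
  -- condition gives Re u ≥ κη, hence |e^{-u}| ≤ e^{-κη}.
  set η := ‖1 - ζ‖ / 4 with hη
  have hη0 : 0 < η := by positivity
  have hpos : 0 < 1 - Real.exp (-(κ * η)) := by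
    rw [sub_pos, Real.exp_lt_one_iff]
    linarith [mul_pos hκ hη0]
  refine ⟨min (2 * η) (1 - Real.exp (-(κ * η))), lt_min (by positivity) hpos, fun u hu hκu => ?_⟩
  rcases le_total ‖u‖ η with h | h
  · refine (min_le_left _ _).trans ?_
    have h1 : ‖Complex.exp (-u) - 1‖ ≤ 2 * ‖-u‖ :=
      Complex.norm_exp_sub_one_le (by rw [norm_neg]; linarith)
    have h2 : 1 - ζ * Complex.exp (-u) = (1 - ζ) - ζ * (Complex.exp (-u) - 1) := by ring
    have h3 := norm_sub_norm_le (1 - ζ) (ζ * (Complex.exp (-u) - 1))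
    rw [norm_mul, hζ, one_mul, ← h2] at h3
    rw [norm_neg] at h1
    linarith
  · refine (min_le_right _ _).trans ?_
    have h3 := norm_sub_norm_le 1 (ζ * Complex.exp (-u))
    rw [norm_mul_exp_neg hζ, norm_one] at h3
    have h4 : Real.exp (-u.re) ≤ Real.exp (-(κ * η)) := by
      rw [Real.exp_le_exp]
      nlinarith
    linarith

theorem exp_neg_mul_le {κ r : ℝ} (hκ : 0 < κ) (hκ1 : κ ≤ 1) (hr : 0 ≤ r) :
    Real.exp (-(κ * r)) ≤ 4 / κ ^ 2 / (1 + r) ^ 2 := by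
  have h1 : κ / 2 * (1 + r) ≤ Real.exp (κ * r / 2) := by
    have := Real.add_one_le_exp (κ * r / 2)
    nlinarith
  have h2 : (κ / 2 * (1 + r)) ^ 2 ≤ Real.exp (κ * r) := by
    have := pow_le_pow_left₀ (by positivity) h1 2
    rwa [← Real.exp_nat_mul, show ((2 : ℕ) : ℝ) * (κ * r / 2) = κ * r by push_cast; ring] at this
  rw [Real.exp_neg, div_div, le_div_iff₀ (by positivity), inv_mul_le_iff₀ (Real.exp_pos _)]
  nlinarith

theorem exists_norm_second_deriv_le {ζ : ℂ} (hζ : ‖ζ‖ = 1) (hζ1 : ζ ≠ 1) {κ : ℝ} (hκ : 0 < κ)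
    (hκ1 : κ ≤ 1) :
    ∃ C : ℝ, ∀ u : ℂ, 0 < u.re → κ * ‖u‖ ≤ u.re →
      ‖-(ζ * Complex.exp (-u)) / (1 - ζ * Complex.exp (-u)) ^ 2‖ ≤ C / (1 + ‖u‖) ^ 2 := by
  obtain ⟨δ, hδ, h⟩ := exists_le_norm_one_sub hζ hζ1 hκ
  refine ⟨4 / κ ^ 2 / δ ^ 2, fun u hu hκu => ?_⟩
  have h1 := h u hu hκu
  have h2 := exp_neg_mul_le hκ hκ1 (norm_nonneg u)
  rw [norm_div, norm_neg, norm_mul_exp_neg hζ, norm_pow]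
  calc Real.exp (-u.re) / ‖1 - ζ * Complex.exp (-u)‖ ^ 2
      ≤ (4 / κ ^ 2 / (1 + ‖u‖) ^ 2) / δ ^ 2 := by
        gcongr
        refine le_trans ?_ h2
        rw [Real.exp_le_exp]
        linarith
    _ = _ := by ring

/-- The left side equals 1/(4 sinh²(a/2)), and sinh(a/2) ≥ a/2. -/
theorem exp_neg_div_sq_le {a : ℝ} (ha : 0 < a) :
    Real.exp (-a) / (1 - Real.exp (-a)) ^ 2 ≤ 1 / a ^ 2 := by
  have h1 : a / 2 ≤ Real.sinh (a / 2) := Real.self_le_sinh_iff.2 (by positivity)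
  rw [Real.sinh_eq] at h1
  have h2 : a * Real.exp (-(a / 2)) ≤ 1 - Real.exp (-a) := by
    have h3 := mul_le_mul_of_nonneg_right h1 (Real.exp_pos (-(a / 2))).le
    have h4 : Real.exp (a / 2) * Real.exp (-(a / 2)) = 1 := by
      rw [← Real.exp_add]; simp
    have h5 : Real.exp (-(a / 2)) * Real.exp (-(a / 2)) = Real.exp (-a) := by
      rw [← Real.exp_add]; ring_nf
    nlinarith
  have h6 : 0 < 1 - Real.exp (-a) := by
    rw [sub_pos, Real.exp_lt_one_iff]; linarith
  rw [div_le_div_iff₀ (by positivity) (by positivity)]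
  have h7 := pow_le_pow_left₀ (by positivity) h2 2
  have h8 : Real.exp (-(a / 2)) ^ 2 = Real.exp (-a) := by
    rw [← Real.exp_nat_mul]; push_cast; ring_nf
  rw [mul_pow, h8] at h7
  linarith

/-- The second derivative of `log ((1 - e^{-u}) / u)` near the origin. -/
theorem norm_inv_sq_sub_le_one {u : ℂ} (hu0 : u ≠ 0) (hu : ‖u‖ ≤ 1) :
    ‖-Complex.exp (-u) / (1 - Complex.exp (-u)) ^ 2 + 1 / u ^ 2‖ ≤ 1 := by
  have hr : 0 < ‖u‖ := norm_pos_iff.2 hu0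
  -- Because (1 - e^{-u})² = e^{-u} D, the expression is (D - u²)/(u² D). The odd Taylor terms
  -- cancel in D, so the numerator is O(u⁴), matching the denominator.
  set D := Complex.exp u + Complex.exp (-u) - 2 with hD
  have hN : ‖D - u ^ 2‖ ≤ ‖u‖ ^ 4 / 4 := by
    have h1 := Complex.exp_bound hu (n := 4) (by norm_num)
    have h2 := Complex.exp_bound (x := -u) (by rwa [norm_neg]) (n := 4) (by norm_num)
    rw [norm_neg] at h2
    have h3 := norm_add_le_of_le h1 h2
    simp only [Finset.sum_range_succ, Finset.range_zero, Finset.sum_empty, Nat.factorial] at h3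
    norm_num at h3
    have e : D - u ^ 2 = Complex.exp u - (1 + u + u ^ 2 / 2 + u ^ 3 / 6) +
        (Complex.exp (-u) - (1 + -u + u ^ 2 / 2 + (-u) ^ 3 / 6)) := by
      rw [hD]; ring
    rw [e]
    refine h3.trans ?_
    nlinarith [pow_pos hr 4]
  have hD2 : ‖u‖ ^ 2 / 2 ≤ ‖D‖ := by
    have h1 := norm_sub_norm_le (u ^ 2) (u ^ 2 - D)
    rw [norm_sub_rev (u ^ 2) D, norm_pow, sub_sub_cancel] at h1
    have h2 : ‖u‖ ^ 4 ≤ ‖u‖ ^ 2 := pow_le_pow_of_le_one hr.le hu (by norm_num)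
    linarith [pow_pos hr 2]
  have hD0 : D ≠ 0 := norm_pos_iff.1 (lt_of_lt_of_le (by positivity) hD2)
  have he : (1 - Complex.exp (-u)) ^ 2 = Complex.exp (-u) * D := by
    have : Complex.exp (-u) * Complex.exp u = 1 := by rw [← Complex.exp_add]; simp
    rw [hD]
    linear_combination -this
  have e : -Complex.exp (-u) / (1 - Complex.exp (-u)) ^ 2 + 1 / u ^ 2 =
      (D - u ^ 2) / (u ^ 2 * D) := by
    rw [he]
    field_simp [Complex.exp_ne_zero (-u)]
    ring
  rw [e, norm_div, norm_mul, norm_pow, div_le_one (by positivity)]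
  nlinarith [pow_pos hr 2, pow_pos hr 4]

/-- The term 1/u², coming from -log u, cancels the double pole of the case ζ = 1. For ‖u‖ ≥ 1 both
terms are separately O(1/‖u‖²). -/
theorem norm_inv_sq_sub_le {κ : ℝ} (hκ : 0 < κ) {u : ℂ} (hu : 0 < u.re)
    (hκu : κ * ‖u‖ ≤ u.re) :
    ‖-(1 * Complex.exp (-u)) / (1 - 1 * Complex.exp (-u)) ^ 2 + 1 / u ^ 2‖ ≤
      4 * (1 / κ ^ 2 + 1) / (1 + ‖u‖) ^ 2 := by
  have hu0 : u ≠ 0 := by rintro rfl; simp at hu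
  have hr : 0 < ‖u‖ := norm_pos_iff.2 hu0
  rw [one_mul]
  rcases le_total ‖u‖ 1 with h | h
  · refine (norm_inv_sq_sub_le_one hu0 h).trans ?_
    rw [le_div_iff₀ (by positivity)]
    have : 0 < 1 / κ ^ 2 := by positivity
    nlinarith
  · have h6 : 0 < 1 - Real.exp (-u.re) := by
      rw [sub_pos, Real.exp_lt_one_iff]; linarith
    have h1 : ‖-Complex.exp (-u) / (1 - Complex.exp (-u)) ^ 2‖ ≤ 1 / (κ * ‖u‖) ^ 2 := by
      rw [norm_div, norm_neg, norm_pow, Complex.norm_exp, Complex.neg_re]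
      have h2 := norm_sub_norm_le 1 (Complex.exp (-u))
      rw [norm_one, Complex.norm_exp, Complex.neg_re] at h2
      calc Real.exp (-u.re) / ‖1 - Complex.exp (-u)‖ ^ 2
          ≤ Real.exp (-u.re) / (1 - Real.exp (-u.re)) ^ 2 := by gcongr
        _ ≤ 1 / u.re ^ 2 := exp_neg_div_sq_le hu
        _ ≤ _ := by gcongr
    refine (norm_add_le _ _).trans ?_
    have h3 : ‖1 / u ^ 2‖ = 1 / ‖u‖ ^ 2 := by simp
    rw [h3]
    calc _ ≤ 1 / (κ * ‖u‖) ^ 2 + 1 / ‖u‖ ^ 2 := by gcongr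
      _ = 4 * (1 / κ ^ 2 + 1) / (‖u‖ + ‖u‖) ^ 2 := by field_simp; ring
      _ ≤ _ := by gcongr

/-! ### Asymptotics of the product over one residue class -/

/-- A factor `∏_{m ≥ 0} (1 - ζ e^{-(m + x) w})`. -/
noncomputable def expProd (ζ : ℂ) (x : ℝ) (w : ℂ) : ℂ :=
  ∏' m : ℕ, (1 - ζ * Complex.exp (-(((m + x : ℝ) : ℂ) * w)))

theorem multipliable_expProd (ζ : ℂ) (x : ℝ) {w : ℂ} (hw : 0 < w.re) :
    Multipliable fun m : ℕ => 1 - ζ * Complex.exp (-(((m + x : ℝ) : ℂ) * w)) := by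
  have h := multipliable_one_sub_mul_pow (ζ * Complex.exp (-((x - 1) * w))) (Complex.exp (-w)) (by
    rw [Complex.norm_exp, Complex.neg_re, Real.exp_lt_one_iff]
    linarith)
  refine h.congr fun m => ?_
  rw [← Complex.exp_nat_mul, mul_assoc, ← Complex.exp_add]
  congr 3
  push_cast
  ring

theorem tendsto_expProd (ζ : ℂ) (x : ℝ) {w : ℂ} (hw : 0 < w.re) :
    Tendsto (fun M => ∏ m ∈ Finset.range M, (1 - ζ * Complex.exp (-(((m + x : ℝ) : ℂ) * w))))
      atTop (𝓝 (expProd ζ x w)) :=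
  (multipliable_expProd ζ x hw).hasProd.tendsto_prod_nat

/-- Partial sums of logarithms are exponentiated before the limit is taken, so the estimate, uniform
in M, passes directly to the infinite product. -/
theorem norm_sub_one_le_of_tendsto {A B : ℕ → ℂ} {L : ℂ} {δ : ℝ} (hδ : δ ≤ 1)
    (h : ∀ᶠ M in atTop, ‖A M - B M‖ ≤ δ)
    (hL : Tendsto (fun M => Complex.exp (A M) * Complex.exp (-B M)) atTop (𝓝 L)) :
    ‖L - 1‖ ≤ 2 * δ := by
  refine le_of_tendsto (hL.sub_const 1).norm ?_
  filter_upwards [h] with M hM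
  rw [← Complex.exp_add, ← sub_eq_add_neg]
  exact (Complex.norm_exp_sub_one_le (hM.trans hδ)).trans (by linarith)

theorem tendsto_mul_exp_neg_nat (ζ : ℂ) {w : ℂ} (hw : 0 < w.re) :
    Tendsto (fun M : ℕ => ζ * Complex.exp (-(M * w))) atTop (𝓝 0) := by
  have h : Tendsto (fun M : ℕ => Complex.exp (-w) ^ M) atTop (𝓝 0) := by
    refine tendsto_pow_atTop_nhds_zero_of_norm_lt_one ?_
    rw [Complex.norm_exp, Complex.neg_re, Real.exp_lt_one_iff]
    linarith
  have h2 := h.const_mul ζ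
  rw [mul_zero] at h2
  refine h2.congr fun M => ?_
  rw [← Complex.exp_nat_mul]
  congr 2
  ring

theorem tendsto_dilog_mul_exp_neg_nat {ζ : ℂ} {w : ℂ} (hw : 0 < w.re) :
    Tendsto (fun M : ℕ => dilog (ζ * Complex.exp (-(M * w)))) atTop (𝓝 0) := by
  have h : ContinuousAt dilog 0 := (hasDerivAt_dilog (by simp)).continuousAt
  have := h.tendsto.comp (tendsto_mul_exp_neg_nat ζ hw)
  rwa [dilog_zero] at this

theorem tendsto_log_one_sub_mul_exp_neg_nat {ζ : ℂ} {w : ℂ} (hw : 0 < w.re) :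
    Tendsto (fun M : ℕ => Complex.log (1 - ζ * Complex.exp (-(M * w)))) atTop (𝓝 0) := by
  have h := (tendsto_mul_exp_neg_nat ζ hw).const_sub 1
  rw [sub_zero] at h
  have := h.clog Complex.one_mem_slitPlane
  rwa [Complex.log_one] at this

theorem tendsto_dilog_ray {ζ w : ℂ} (hζ : ‖ζ‖ = 1) (hw : 0 < w.re) :
    Tendsto (fun ε : ℝ => dilog (ζ * Complex.exp (-((ε : ℂ) * w)))) (𝓝[>] 0)
      (𝓝 (dilog ζ)) := by
  have h1 : Tendsto dilog (𝓝[Metric.closedBall 0 1] ζ) (𝓝 (dilog ζ)) :=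
    continuousOn_dilog ζ (by simp [hζ])
  refine h1.comp (tendsto_nhdsWithin_iff.2 ⟨tendsto_nhdsWithin_of_tendsto_nhds ?_, ?_⟩)
  · have : Continuous fun ε : ℝ => ζ * Complex.exp (-((ε : ℂ) * w)) := by fun_prop
    simpa using this.tendsto 0
  · filter_upwards [self_mem_nhdsWithin] with ε hε
    have hε : 0 < ε := hε
    rw [mem_closedBall_zero_iff]
    refine (norm_mul_exp_neg_lt hζ ?_).le
    rw [Complex.re_ofReal_mul]
    exact mul_pos hε hw

theorem exp_log_one_sub {y : ℂ} (hy : ‖y‖ < 1) : Complex.exp (Complex.log (1 - y)) = 1 - y :=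
  Complex.exp_log (Complex.slitPlane_ne_zero (one_sub_mem_slitPlane hy))

theorem re_natCast_add_mul_pos {w : ℂ} (hw : 0 < w.re) {x : ℝ} (hx : 0 < x) (m : ℕ) :
    0 < (((m + x : ℝ) : ℂ) * w).re := by
  rw [Complex.re_ofReal_mul]
  positivity

theorem one_sub_mem_slitPlane_of_norm_eq_one {ζ : ℂ} (hζ : ‖ζ‖ = 1) (hζ1 : ζ ≠ 1) :
    1 - ζ ∈ Complex.slitPlane := by
  refine Complex.mem_slitPlane_iff.2 ?_
  by_contra! h
  have h1 : ζ.im = 0 := by simpa using h.2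
  have h2 : 1 ≤ ζ.re := by simpa using h.1
  have h3 := Complex.re_le_norm ζ
  exact hζ1 (Complex.ext (by rw [Complex.one_re]; linarith) (by simpa using h1))

/-- The boundary terms at Mw vanish as M → ∞, leaving those at 0, namely Li₂(ζ) and log(1 - ζ). The
latter is finite and continuous there because ζ ≠ 1. -/
theorem exists_norm_expProd_sub_one_le {ζ : ℂ} (hζ : ‖ζ‖ = 1) (hζ1 : ζ ≠ 1) {κ : ℝ}
    (hκ : 0 < κ) (hκ1 : κ ≤ 1) {x : ℝ} (hx0 : 0 < x) (hx1 : x ≤ 1) :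
    ∃ C : ℝ, ∀ w : ℂ, 0 < w.re → κ * ‖w‖ ≤ w.re → ‖w‖ ≤ 1 → C * ‖w‖ ≤ 1 →
      ‖expProd ζ x w * Complex.exp (dilog ζ / w - (1 / 2 - x) * Complex.log (1 - ζ)) - 1‖ ≤
        2 * (C * ‖w‖) := by
  obtain ⟨C, hC⟩ := exists_norm_second_deriv_le hζ hζ1 hκ hκ1
  refine ⟨6 * C, fun w hw hwκ hw1 hCw => ?_⟩
  have hslit := one_sub_mem_slitPlane_of_norm_eq_one hζ hζ1
  have hf₀ : Tendsto (fun ε : ℝ => Complex.log (1 - ζ * Complex.exp (-((ε : ℂ) * w)))) (𝓝[>] 0)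
      (𝓝 (Complex.log (1 - ζ))) := by
    refine Tendsto.clog (tendsto_nhdsWithin_of_tendsto_nhds ?_) hslit
    have : Continuous fun ε : ℝ => 1 - ζ * Complex.exp (-((ε : ℂ) * w)) := by fun_prop
    simpa using this.tendsto 0
  have key := fun M : ℕ => norm_sum_sub_le (M := M)
    (fun u hu => hasDerivAt_dilog_mul_exp_neg hζ hu)
    (fun u hu => hasDerivAt_log_one_sub hζ hu) (fun u hu => hasDerivAt_div_one_sub hζ hu) hC hw
    hwκ hw1 hx0 hx1 (tendsto_dilog_ray hζ hw) hf₀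
  refine norm_sub_one_le_of_tendsto hCw ((eventually_gt_atTop 0).mono key) ?_
  refine Tendsto.mul ((tendsto_expProd ζ x hw).congr fun M => ?_) ?_
  · rw [Complex.exp_sum]
    refine Finset.prod_congr rfl fun m _ => ?_
    exact (exp_log_one_sub (norm_mul_exp_neg_lt hζ (re_natCast_add_mul_pos hw hx0 m))).symm
  · have h := ((((tendsto_dilog_mul_exp_neg_nat (ζ := ζ) hw).sub_const (dilog ζ)).div_const w).sub
      (((tendsto_log_one_sub_mul_exp_neg_nat (ζ := ζ) hw).sub_const
        (Complex.log (1 - ζ))).const_mul (1 / 2 - (x : ℂ)))).neg.cexp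
    convert h using 3
    ring

/-- Stirling's formula for the shifted factorials `x (x + 1) ⋯ (x + M - 1)`. -/
theorem tendsto_exp_div_prod_add {x : ℝ} (hx : 0 < x) :
    Tendsto (fun M : ℕ => Real.exp (M * Real.log M - M - (1 / 2 - x) * Real.log M) /
      ∏ m ∈ Finset.range M, ((m : ℝ) + x)) atTop
      (𝓝 (Real.Gamma x / Real.sqrt (2 * Real.pi))) := by
  have h1 := Real.GammaSeq_tendsto_Gamma x
  have h2 := (Stirling.tendsto_stirlingSeq_sqrt_pi.const_mul (Real.sqrt 2)).inv₀
    (by positivity)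
  -- `GammaSeq` has M + 1 factors in its denominator; the factor (x + M)/M → 1 removes the last one.
  have h3 : Tendsto (fun M : ℕ => x * (M : ℝ)⁻¹ + 1) atTop (𝓝 1) := by
    simpa using (tendsto_inv_atTop_nhds_zero_nat (𝕜 := ℝ)).const_mul x |>.add_const 1
  have h := (h1.mul h2).mul h3
  rw [mul_one, ← Real.sqrt_mul (by norm_num), ← div_eq_mul_inv] at h
  refine h.congr' ?_
  filter_upwards [eventually_gt_atTop 0] with M hM
  have hM0 : (0 : ℝ) < M := by exact_mod_cast hM
  have hP : 0 < ∏ m ∈ Finset.range M, ((m : ℝ) + x) :=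
    Finset.prod_pos fun m _ => by positivity
  have hsq : Real.sqrt 2 * Real.sqrt (2 * M) = 2 * Real.sqrt M := by
    rw [Real.sqrt_mul (by norm_num), ← mul_assoc, Real.mul_self_sqrt (by norm_num)]
  have hexp : Real.exp (M * Real.log M - M - (1 / 2 - x) * Real.log M) =
      M ^ M * (M : ℝ) ^ x / (Real.exp 1 ^ M * Real.sqrt M) := by
    rw [Real.sqrt_eq_rpow, Real.rpow_def_of_pos hM0, Real.rpow_def_of_pos hM0,
      ← Real.exp_nat_mul, ← Real.exp_log (x := (M : ℝ) ^ M) (by positivity), Real.log_pow,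
      ← Real.exp_add, ← Real.exp_add, ← Real.exp_sub]
    congr 1
    ring
  rw [hexp, Real.GammaSeq, Stirling.stirlingSeq, Finset.prod_range_succ,
    Finset.prod_congr rfl fun (m : ℕ) _ => add_comm x (m : ℝ), div_pow]
  have hf : (0 : ℝ) < (M.factorial : ℝ) := by exact_mod_cast M.factorial_pos
  have hs : 0 < Real.sqrt M := by positivity
  have hs2 : Real.sqrt M * Real.sqrt M = M := Real.mul_self_sqrt hM0.le
  have e : Real.sqrt 2 * ((M.factorial : ℝ) / (Real.sqrt (2 * M) * (M ^ M / Real.exp 1 ^ M))) =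
      M.factorial * Real.exp 1 ^ M / (Real.sqrt M * M ^ M) := by
    have h0 : 0 < Real.sqrt (2 * M) := by positivity
    have h2 : Real.sqrt 2 * Real.sqrt M = Real.sqrt (2 * M) := (Real.sqrt_mul (by norm_num) _).symm
    rw [← h2]
    field_simp
  rw [e]
  have hxM : x + (M : ℝ) ≠ 0 := by positivity
  have h4 : x * (M : ℝ)⁻¹ + 1 = (x + M) / (Real.sqrt M * Real.sqrt M) := by
    rw [hs2]
    field_simp
  rw [h4]
  field_simp

/-- Dividing both arguments by ε > 0 shifts both logarithms equally, so the claim follows from (1 -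
e^{-εw})/ε → w. -/
theorem tendsto_log_one_sub_sub_log_ray {w : ℂ} (hw : 0 < w.re) :
    Tendsto (fun ε : ℝ => Complex.log (1 - 1 * Complex.exp (-((ε : ℂ) * w))) -
      Complex.log ((ε : ℂ) * w)) (𝓝[>] 0) (𝓝 0) := by
  have hw0 : w ≠ 0 := by rintro rfl; simp at hw
  have hd : HasDerivAt (fun ε : ℝ => 1 - Complex.exp (-((ε : ℂ) * w))) w 0 := by
    have e : HasDerivAt (fun s : ℝ => (s : ℂ)) 1 0 := Complex.ofRealCLM.hasDerivAt (x := (0 : ℝ))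
    exact (((e.mul_const w).fun_neg.cexp).const_sub 1).congr_deriv (by simp)
  have h1 : Tendsto (fun ε : ℝ => ((ε⁻¹ : ℝ) : ℂ) * (1 - Complex.exp (-((ε : ℂ) * w))))
      (𝓝[>] 0) (𝓝 w) := by
    have := (hasDerivAt_iff_tendsto_slope_zero.1 hd).mono_left
      (nhdsWithin_mono 0 (show Set.Ioi (0 : ℝ) ⊆ {0}ᶜ from fun x hx => ne_of_gt hx))
    simpa using this
  have h2 := (h1.clog (Or.inl hw)).sub_const (Complex.log w)
  rw [sub_self] at h2
  refine h2.congr' ?_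
  filter_upwards [self_mem_nhdsWithin] with ε hε
  have hε : 0 < ε := hε
  have hlt : ‖1 * Complex.exp (-((ε : ℂ) * w))‖ < 1 := by
    refine norm_mul_exp_neg_lt norm_one ?_
    rw [Complex.re_ofReal_mul]
    positivity
  have h0 := Complex.slitPlane_ne_zero (one_sub_mem_slitPlane hlt)
  rw [one_mul] at h0
  rw [Complex.log_ofReal_mul (inv_pos.2 hε) h0, Complex.log_ofReal_mul hε hw0, Real.log_inv,
    one_mul]
  push_cast
  ring

theorem tendsto_mul_log_sub_ray {w : ℂ} (hw : 0 < w.re) :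
    Tendsto (fun ε : ℝ => (ε : ℂ) * w * Complex.log ((ε : ℂ) * w) - (ε : ℂ) * w)
      (𝓝[>] 0) (𝓝 0) := by
  have hw0 : w ≠ 0 := by rintro rfl; simp at hw
  have h1 : Continuous fun ε : ℝ =>
      ((ε * Real.log ε : ℝ) : ℂ) * w + ε * w * Complex.log w - ε * w := by
    have := Real.continuous_mul_log
    fun_prop
  have h2 := tendsto_nhdsWithin_of_tendsto_nhds (s := Set.Ioi 0) (h1.tendsto 0)
  simp only [zero_mul, Complex.ofReal_zero, add_zero, sub_zero] at h2
  refine h2.congr' ?_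
  filter_upwards [self_mem_nhdsWithin] with ε hε
  rw [Complex.log_ofReal_mul hε hw0]
  push_cast
  ring

/-- Euler–Maclaurin is applied to log(1 - e^{-u}) - log u, which tends to 0 at the origin, with
antiderivative Li₂(e^{-u}) - (u log u - u). The subtracted logarithms reappear as the product of the
(m+x)w. -/
theorem exists_norm_expProd_one_sub_one_le {κ : ℝ} (hκ : 0 < κ) {x : ℝ} (hx0 : 0 < x)
    (hx1 : x ≤ 1) :
    ∃ C : ℝ, ∀ w : ℂ, 0 < w.re → κ * ‖w‖ ≤ w.re → ‖w‖ ≤ 1 → C * ‖w‖ ≤ 1 →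
      ‖expProd 1 x w * ((Real.Gamma x / Real.sqrt (2 * Real.pi) : ℝ) : ℂ) *
          Complex.exp (Real.pi ^ 2 / 6 / w - (1 / 2 - x) * Complex.log w) - 1‖ ≤
        2 * (C * ‖w‖) := by
  refine ⟨6 * (4 * (1 / κ ^ 2 + 1)), fun w hw hwκ hw1 hCw => ?_⟩
  have hw0 : w ≠ 0 := by rintro rfl; simp at hw
  have hn1 : ‖(1 : ℂ)‖ = 1 := norm_one
  have hF₀ : Tendsto (fun ε : ℝ => dilog (1 * Complex.exp (-((ε : ℂ) * w))) -
      ((ε : ℂ) * w * Complex.log ((ε : ℂ) * w) - (ε : ℂ) * w)) (𝓝[>] 0)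
      (𝓝 (Real.pi ^ 2 / 6)) := by
    simpa [dilog_one] using (tendsto_dilog_ray hn1 hw).sub (tendsto_mul_log_sub_ray hw)
  have hsl : ∀ u : ℂ, 0 < u.re → u ∈ Complex.slitPlane := fun u hu => Or.inl hu
  have key := fun M : ℕ => norm_sum_sub_le (M := M) (κ := κ)
    (F := fun u => dilog (1 * Complex.exp (-u)) - (u * Complex.log u - u))
    (f := fun u => Complex.log (1 - 1 * Complex.exp (-u)) - Complex.log u)
    (f' := fun u => 1 * Complex.exp (-u) / (1 - 1 * Complex.exp (-u)) - u⁻¹)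
    (f'' := fun u => -(1 * Complex.exp (-u)) / (1 - 1 * Complex.exp (-u)) ^ 2 + 1 / u ^ 2)
    (fun u hu => by
      have h0 := Complex.slitPlane_ne_zero (hsl u hu)
      refine ((hasDerivAt_dilog_mul_exp_neg hn1 hu).fun_sub
        (((hasDerivAt_id u).fun_mul (Complex.hasDerivAt_log (hsl u hu))).fun_sub
          (hasDerivAt_id u))).congr_deriv ?_
      simp only [id]
      field_simp
      ring)
    (fun u hu => (hasDerivAt_log_one_sub hn1 hu).fun_sub (Complex.hasDerivAt_log (hsl u hu)))
    (fun u hu => ((hasDerivAt_div_one_sub hn1 hu).fun_sub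
      (hasDerivAt_inv (Complex.slitPlane_ne_zero (hsl u hu)))).congr_deriv (by ring))
    (fun u hu hκu => norm_inv_sq_sub_le hκ hu hκu) hw
    hwκ hw1 hx0 hx1 hF₀ (tendsto_log_one_sub_sub_log_ray hw)
  refine norm_sub_one_le_of_tendsto hCw ((eventually_gt_atTop 0).mono key) ?_
  -- The terms in M log M, M and log M diverge separately; they are grouped with the shifted
  -- factorial so that Stirling's formula absorbs them.
  have hlim := ((tendsto_expProd 1 x hw).mul
    ((Complex.continuous_ofReal.tendsto _).comp (tendsto_exp_div_prod_add hx0))).mul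
    ((((tendsto_dilog_mul_exp_neg_nat (ζ := 1) hw).neg.div_const w).add_const
      (Real.pi ^ 2 / 6 / w - (1 / 2 - x) * Complex.log w)).add
      ((tendsto_log_one_sub_mul_exp_neg_nat (ζ := 1) hw).const_mul (1 / 2 - (x : ℂ)))).cexp
  simp only [neg_zero, zero_div, zero_add, mul_zero, add_zero] at hlim
  refine hlim.congr' ?_
  filter_upwards [eventually_gt_atTop 0] with M hM
  have hM0 : (0 : ℝ) < M := by exact_mod_cast hM
  have hlogM : Complex.log (M * w) = Real.log M + Complex.log w := by
    have := Complex.log_ofReal_mul hM0 hw0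
    simpa using this
  have hA : Complex.exp (∑ m ∈ Finset.range M,
      (Complex.log (1 - 1 * Complex.exp (-(((m + x : ℝ) : ℂ) * w))) -
        Complex.log (((m + x : ℝ) : ℂ) * w))) =
      (∏ m ∈ Finset.range M, (1 - 1 * Complex.exp (-(((m + x : ℝ) : ℂ) * w)))) /
        ((∏ m ∈ Finset.range M, ((m + x : ℝ) : ℂ)) * Complex.exp (M * Complex.log w)) := by
    rw [Complex.exp_sum, Complex.exp_nat_mul, Complex.exp_log hw0]
    have : w ^ M = ∏ m ∈ Finset.range M, w := by simp
    rw [this, ← Finset.prod_mul_distrib, ← Finset.prod_div_distrib]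
    refine Finset.prod_congr rfl fun m _ => ?_
    have hre := re_natCast_add_mul_pos hw hx0 m
    rw [Complex.exp_sub, exp_log_one_sub (norm_mul_exp_neg_lt hn1 hre),
      Complex.exp_log (Complex.slitPlane_ne_zero (hsl _ hre))]
  rw [hA]
  have hprod : (∏ m ∈ Finset.range M, ((m + x : ℝ) : ℂ)) ≠ 0 :=
    Finset.prod_ne_zero_iff.2 fun m _ => by
      rw [Complex.ofReal_ne_zero]
      positivity
  simp only [Function.comp_apply, hlogM]
  rw [div_mul_eq_mul_div, eq_div_iff (mul_ne_zero hprod (Complex.exp_ne_zero _))]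
  have hb : ((Real.exp (M * Real.log M - M - (1 / 2 - x) * Real.log M) /
      ∏ m ∈ Finset.range M, ((m : ℝ) + x) : ℝ) : ℂ) * (∏ m ∈ Finset.range M, ((m + x : ℝ) : ℂ)) =
      Complex.exp (M * Real.log M - M - (1 / 2 - x) * Real.log M) := by
    rw [Complex.ofReal_div, Complex.ofReal_prod, div_mul_cancel₀ _ hprod, Complex.ofReal_exp]
    push_cast
    rfl
  rw [show ∀ p q r s t : ℂ, p * q * r * (s * t) = p * ((q * s) * (r * t)) from
    fun p q r s t => by ring, hb, ← Complex.exp_add, ← Complex.exp_add]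
  congr 2
  field_simp
  ring

/-! ### Calculus of relative errors 1 + O(|z|), and the cone -/

theorem EqOneAddBigO.mul {l : Filter ℂ} (hl : l ≤ 𝓝 0) {f g f' g' : ℂ → ℂ}
    (h : EqOneAddBigO l f g) (h' : EqOneAddBigO l f' g') :
    EqOneAddBigO l (fun z => f z * f' z) fun z => g z * g' z := by
  obtain ⟨E, hE, hf⟩ := h
  obtain ⟨E', hE', hf'⟩ := h'
  refine ⟨fun z => E z + E' z + E z * E' z, (hE.add hE').add ?_, ?_⟩
  · have h1 : E' =O[l] fun _ => (1 : ℝ) := hE'.trans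
      (((continuous_norm.tendsto (0 : ℂ)).mono_left hl).isBigO_one ℝ)
    simpa using hE.mul h1
  · filter_upwards [hf, hf'] with z h1 h2
    rw [h1, h2]
    ring

theorem EqOneAddBigO.prod {l : Filter ℂ} (hl : l ≤ 𝓝 0) {ι : Type*} (s : Finset ι)
    {f g : ι → ℂ → ℂ} (h : ∀ i ∈ s, EqOneAddBigO l (f i) (g i)) :
    EqOneAddBigO l (fun z => ∏ i ∈ s, f i z) fun z => ∏ i ∈ s, g i z := by
  classical
  induction s using Finset.induction_on with
  | empty => exact ⟨fun _ => 0, isBigO_zero _ _, by simp⟩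
  | insert i s hi ih =>
    simp only [Finset.prod_insert hi]
    exact (h i (Finset.mem_insert_self i s)).mul hl
      (ih fun j hj => h j (Finset.mem_insert_of_mem hj))

theorem EqOneAddBigO.congr' {l : Filter ℂ} {f g f' g' : ℂ → ℂ} (h : EqOneAddBigO l f g)
    (hf : f =ᶠ[l] f') (hg : g =ᶠ[l] g') : EqOneAddBigO l f' g' := by
  obtain ⟨E, hE, h⟩ := h
  refine ⟨E, hE, ?_⟩
  filter_upwards [h, hf, hg] with z h1 h2 h3
  rw [← h2, ← h3, h1]

theorem EqOneAddBigO.isEquivalent {l : Filter ℂ} (hl : l ≤ 𝓝 0) {f g : ℂ → ℂ}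
    (h : EqOneAddBigO l f g) : IsEquivalent l f g := by
  obtain ⟨E, hE, h⟩ := h
  have hE0 : Tendsto E l (𝓝 0) := hE.trans_tendsto (by
    simpa using (continuous_norm.tendsto (0 : ℂ)).mono_left hl)
  have h1 : (fun z => g z * E z) =o[l] g := by
    simpa using (isBigO_refl g l).mul_isLittleO ((isLittleO_one_iff ℂ).2 hE0)
  refine h1.congr' ?_ EventuallyEq.rfl
  filter_upwards [h] with z hz
  rw [Pi.sub_apply, hz]
  ring

theorem toZeroIn_le (θ : ℝ) : toZeroIn θ ≤ 𝓝 0 := nhdsWithin_le_nhds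

section Cone

variable {θ : ℝ}

/-- This supplies the sector constant κ = cos θ. -/
theorem cos_mul_norm_le_re (hθ0 : 0 ≤ θ) (hθ : θ < Real.pi / 2) {z : ℂ} (hz : z ∈ cone θ) :
    Real.cos θ * ‖z‖ ≤ z.re := by
  obtain ⟨r, α, hr, hα, rfl⟩ := hz
  rw [norm_mul, Complex.norm_real, Real.norm_of_nonneg hr, mul_comm Complex.I,
    Complex.norm_exp_ofReal_mul_I, Complex.re_ofReal_mul, Complex.exp_ofReal_mul_I_re, mul_one,
    mul_comm]
  refine mul_le_mul_of_nonneg_left ?_ hr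
  rw [← Real.cos_abs α]
  exact Real.cos_le_cos_of_nonneg_of_le_pi (abs_nonneg α) (by linarith [Real.pi_pos]) hα

theorem cos_pos_of_angle (hθ0 : 0 ≤ θ) (hθ : θ < Real.pi / 2) : 0 < Real.cos θ :=
  Real.cos_pos_of_mem_Ioo ⟨by linarith [Real.pi_pos], hθ⟩

theorem re_pos_of_mem_cone (hθ0 : 0 ≤ θ) (hθ : θ < Real.pi / 2) {z : ℂ}
    (hz : z ∈ cone θ \ {0}) : 0 < z.re :=
  (mul_pos (cos_pos_of_angle hθ0 hθ) (norm_pos_iff.2 hz.2)).trans_le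
    (cos_mul_norm_le_re hθ0 hθ hz.1)

theorem eventually_re_pos (hθ0 : 0 ≤ θ) (hθ : θ < Real.pi / 2) : ∀ᶠ z in toZeroIn θ, 0 < z.re := by
  filter_upwards [show cone θ \ {0} ∈ toZeroIn θ from self_mem_nhdsWithin] with z hz
  exact re_pos_of_mem_cone hθ0 hθ hz

/-- Positive dilations preserve arguments, which permits the substitution w = Nz. -/
theorem tendsto_mul_toZeroIn (θ : ℝ) {c : ℝ} (hc : 0 < c) :
    Tendsto (fun z : ℂ => (c : ℂ) * z) (toZeroIn θ) (toZeroIn θ) := by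
  refine tendsto_nhdsWithin_iff.2 ⟨?_, ?_⟩
  · have : Continuous fun z : ℂ => (c : ℂ) * z := by fun_prop
    simpa using (this.tendsto 0).mono_left (toZeroIn_le θ)
  · filter_upwards [show cone θ \ {0} ∈ toZeroIn θ from self_mem_nhdsWithin] with z hz
    obtain ⟨⟨r, α, hr, hα, rfl⟩, h0⟩ := hz
    refine ⟨⟨c * r, α, by positivity, hα, by push_cast; ring⟩, ?_⟩
    exact mul_ne_zero (Complex.ofReal_ne_zero.2 hc.ne') h0

theorem EqOneAddBigO.comp_mul {f g : ℂ → ℂ} (h : EqOneAddBigO (toZeroIn θ) f g) {c : ℝ}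
    (hc : 0 < c) :
    EqOneAddBigO (toZeroIn θ) (fun z => f (c * z)) fun z => g (c * z) := by
  obtain ⟨E, hE, h⟩ := h
  have ht := tendsto_mul_toZeroIn θ hc
  refine ⟨fun z => E (c * z), (hE.comp_tendsto ht).trans ?_, ht.eventually h⟩
  refine IsBigO.of_bound c (Eventually.of_forall fun z => ?_)
  simp [abs_of_pos hc]

theorem eqOneAddBigO_of_bound (hθ0 : 0 ≤ θ) (hθ : θ < Real.pi / 2) {f g H : ℂ → ℂ} {C : ℝ}
    (hgH : ∀ z : ℂ, 0 < z.re → g z * H z = 1)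
    (h : ∀ w : ℂ, 0 < w.re → Real.cos θ * ‖w‖ ≤ w.re → ‖w‖ ≤ 1 → C * ‖w‖ ≤ 1 →
      ‖f w * H w - 1‖ ≤ 2 * (C * ‖w‖)) : EqOneAddBigO (toZeroIn θ) f g := by
  have hlim : Tendsto (fun w : ℂ => ‖w‖) (toZeroIn θ) (𝓝 0) := by
    simpa using (continuous_norm.tendsto (0 : ℂ)).mono_left (toZeroIn_le θ)
  have hlimC : Tendsto (fun w : ℂ => C * ‖w‖) (toZeroIn θ) (𝓝 0) := by
    simpa using hlim.const_mul C
  refine ⟨fun z => f z * H z - 1, ?_, ?_⟩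
  · refine IsBigO.of_bound (2 * C) ?_
    filter_upwards [show cone θ \ {0} ∈ toZeroIn θ from self_mem_nhdsWithin,
      hlim.eventually (eventually_le_nhds zero_lt_one),
      hlimC.eventually (eventually_le_nhds zero_lt_one)] with w hw h1 h2
    rw [norm_norm, mul_assoc]
    exact h w (re_pos_of_mem_cone hθ0 hθ hw) (cos_mul_norm_le_re hθ0 hθ hw.1) h1 h2
  · filter_upwards [eventually_re_pos hθ0 hθ] with z hz
    linear_combination -f z * hgH z hz

theorem eqOneAddBigO_expProd (hθ0 : 0 ≤ θ) (hθ : θ < Real.pi / 2) {ζ : ℂ} (hζ : ‖ζ‖ = 1)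
    (hζ1 : ζ ≠ 1) {x : ℝ} (hx0 : 0 < x) (hx1 : x ≤ 1) :
    EqOneAddBigO (toZeroIn θ) (expProd ζ x)
      fun w => Complex.exp (-(dilog ζ / w) + (1 / 2 - x) * Complex.log (1 - ζ)) := by
  obtain ⟨C, hC⟩ := exists_norm_expProd_sub_one_le hζ hζ1 (cos_pos_of_angle hθ0 hθ)
    (Real.cos_le_one θ) hx0 hx1
  refine eqOneAddBigO_of_bound hθ0 hθ (fun z _ => ?_) hC
  rw [← Complex.exp_add, Complex.exp_eq_one_iff]
  exact ⟨0, by push_cast; ring⟩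

theorem eqOneAddBigO_expProd_one (hθ0 : 0 ≤ θ) (hθ : θ < Real.pi / 2) {x : ℝ} (hx0 : 0 < x)
    (hx1 : x ≤ 1) :
    EqOneAddBigO (toZeroIn θ) (expProd 1 x)
      fun w => Real.sqrt (2 * Real.pi) / Real.Gamma x *
        Complex.exp (-(Real.pi ^ 2 / 6 / w) + (1 / 2 - x) * Complex.log w) := by
  obtain ⟨C, hC⟩ := exists_norm_expProd_one_sub_one_le (cos_pos_of_angle hθ0 hθ) hx0 hx1
  refine eqOneAddBigO_of_bound hθ0 hθ
    (H := fun w => ((Real.Gamma x / Real.sqrt (2 * Real.pi) : ℝ) : ℂ) *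
      Complex.exp (Real.pi ^ 2 / 6 / w - (1 / 2 - x) * Complex.log w)) (fun z _ => ?_)
    (by simpa only [mul_assoc] using hC)
  have h1 : Complex.exp (-(Real.pi ^ 2 / 6 / z) + (1 / 2 - x) * Complex.log z) *
      Complex.exp (Real.pi ^ 2 / 6 / z - (1 / 2 - x) * Complex.log z) = 1 := by
    rw [← Complex.exp_add, Complex.exp_eq_one_iff]
    exact ⟨0, by push_cast; ring⟩
  have h2 : ((Real.Gamma x : ℝ) : ℂ) ≠ 0 := Complex.ofReal_ne_zero.2 (Real.Gamma_pos_of_pos hx0).ne'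
  have h3 : ((Real.sqrt (2 * Real.pi) : ℝ) : ℂ) ≠ 0 :=
    Complex.ofReal_ne_zero.2 (by positivity)
  rw [mul_mul_mul_comm, h1, Complex.ofReal_div]
  field_simp

end Cone

/-! ### Residue classes and sums over roots of unity -/

theorem prod_range_mul_eq {α : Type*} [CommMonoid α] (g : ℕ → α) (N M : ℕ) :
    ∏ n ∈ Finset.range (N * M), g n =
      ∏ j ∈ Finset.range N, ∏ m ∈ Finset.range M, g (N * m + j) := by
  rw [Finset.prod_comm]
  induction M with
  | zero => simp
  | succ M ih => rw [Nat.mul_succ, Finset.prod_range_add, ih, Finset.prod_range_succ]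

/-- Splitting a product with periodic coefficients into residue classes. -/
theorem tprod_eq_prod_expProd {c : ℕ → ℂ} {N : ℕ} (hN : 0 < N) (hc : ∀ m j, c (N * m + j) = c j)
    {w : ℂ} (hw : 0 < w.re)
    (hm : Multipliable fun n : ℕ => 1 - c n * Complex.exp (-(((n : ℂ) + 1) * w))) :
    ∏' n : ℕ, (1 - c n * Complex.exp (-(((n : ℂ) + 1) * w))) =
      ∏ j ∈ Finset.range N, expProd (c j) (((j : ℝ) + 1) / N) (((N : ℝ) : ℂ) * w) := by
  have hN0 : (N : ℂ) ≠ 0 := Nat.cast_ne_zero.2 hN.ne'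
  have hNw : 0 < (((N : ℝ) : ℂ) * w).re := by
    rw [Complex.re_ofReal_mul]
    positivity
  -- Partial products of length NM suffice. The index n = Nm + j carries the exponent n + 1 = N(m +
  -- (j+1)/N), whence x = (j+1)/N.
  have h1 : Tendsto (fun M : ℕ => N * M) atTop atTop := tendsto_id.const_mul_atTop' hN
  have h2 := hm.hasProd.tendsto_prod_nat.comp h1
  refine tendsto_nhds_unique h2 ((tendsto_finsetProd (Finset.range N) fun j _ =>
    tendsto_expProd (c j) (((j : ℝ) + 1) / N) hNw).congr fun M => ?_)
  rw [Function.comp_apply, prod_range_mul_eq]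
  refine Finset.prod_congr rfl fun j _ => Finset.prod_congr rfl fun m _ => ?_
  rw [hc]
  congr 4
  push_cast
  field_simp
  ring

theorem sum_pow_mul_eq {ζ : ℂ} {N : ℕ} (hζ : IsPrimitiveRoot ζ N) (k : ℕ) :
    ∑ j ∈ Finset.range N, (ζ ^ j) ^ k = if N ∣ k then (N : ℂ) else 0 := by
  have e : ∑ j ∈ Finset.range N, (ζ ^ j) ^ k = ∑ j ∈ Finset.range N, (ζ ^ k) ^ j :=
    Finset.sum_congr rfl fun j _ => by rw [← pow_mul, ← pow_mul, mul_comm]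
  rw [e]
  split_ifs with h
  · simp [(hζ.pow_eq_one_iff_dvd k).2 h]
  · rw [geom_sum_eq (fun h1 => h ((hζ.pow_eq_one_iff_dvd k).1 h1)), ← pow_mul, mul_comm, pow_mul,
      hζ.pow_eq_one, one_pow, sub_self, zero_div]

/-- The distribution relation for the dilogarithm at the roots of unity. -/
theorem sum_dilog_pow {ζ : ℂ} {N : ℕ} (hN : 0 < N) (hζ : IsPrimitiveRoot ζ N) :
    ∑ j ∈ Finset.range N, dilog (ζ ^ j) = Real.pi ^ 2 / 6 / N := by
  have hn : ‖ζ‖ = 1 := hζ.norm'_eq_one hN.ne'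
  have hN0 : (N : ℂ) ≠ 0 := Nat.cast_ne_zero.2 hN.ne'
  have h1 : ∑ j ∈ Finset.range N, dilog (ζ ^ j) =
      ∑' n : ℕ, (if N ∣ n + 1 then (N : ℂ) else 0) / ((n : ℂ) + 1) ^ 2 := by
    simp only [dilog]
    rw [← Summable.tsum_finsetSum fun j _ => summable_dilog (by rw [norm_pow, hn, one_pow])]
    refine tsum_congr fun n => ?_
    rw [← sum_pow_mul_eq hζ, Finset.sum_div]
  -- Orthogonality keeps only the terms with N ∣ n + 1, that is n + 1 = N(m + 1), and N/(N(m+1))² =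
  -- (1/N)/(m+1)².
  have hinj : Function.Injective fun m : ℕ => N * m + (N - 1) := fun m m' h =>
    Nat.eq_of_mul_eq_mul_left hN (Nat.add_right_cancel h)
  rw [h1, ← hinj.tsum_eq (f := fun n : ℕ => (if N ∣ n + 1 then (N : ℂ) else 0) / ((n : ℂ) + 1) ^ 2),
    ← dilog_one, dilog, ← tsum_div_const]
  · refine tsum_congr fun m => ?_
    have e : N * m + (N - 1) + 1 = N * (m + 1) := by
      rw [add_assoc, Nat.sub_add_cancel hN, Nat.mul_succ]
    have e2 : (((N * m + (N - 1) : ℕ) : ℂ) + 1) = N * (m + 1) := by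
      exact_mod_cast congrArg (Nat.cast (R := ℂ)) e
    simp only [e2, e, dvd_mul_right, if_true, one_pow]
    have : (m : ℂ) + 1 ≠ 0 := Nat.cast_add_one_ne_zero m
    field_simp
  · intro n hn
    have h2 : N ∣ n + 1 := by
      by_contra h
      simp [h] at hn
    obtain ⟨m, hm⟩ := h2
    rcases m with _ | m
    · simp at hm
    · refine ⟨m, ?_⟩
      rw [Nat.mul_succ] at hm
      simp only
      omega

/-- With φ the fractional part, 1 - e^{2πiφ} = 2 sin(πφ) e^{i(πφ - π/2)}, and the angle lies in
(-π/2, π/2). -/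
theorem arg_one_sub_exp {y : ℝ} (hy : Int.fract y ≠ 0) :
    (1 - Complex.exp (2 * Real.pi * Complex.I * y)).arg = Real.pi * sawtooth y := by
  set φ := Int.fract y with hφ
  have h0 : 0 < φ := lt_of_le_of_ne (Int.fract_nonneg y) hy.symm
  have h1 : φ < 1 := Int.fract_lt_one y
  have hsin : 0 < Real.sin (Real.pi * φ) :=
    Real.sin_pos_of_pos_of_lt_pi (by positivity) (by nlinarith [Real.pi_pos])
  have e1 : Complex.exp (2 * Real.pi * Complex.I * y) =
      Complex.exp (((2 * (Real.pi * φ) : ℝ) : ℂ) * Complex.I) := by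
    rw [Complex.exp_eq_exp_iff_exists_int]
    refine ⟨⌊y⌋, ?_⟩
    have : (y : ℂ) = (⌊y⌋ : ℂ) + (φ : ℂ) := by
      exact_mod_cast (Int.floor_add_fract y).symm
    rw [this]
    push_cast
    ring
  have e2 : 1 - Complex.exp (2 * Real.pi * Complex.I * y) =
      ((2 * Real.sin (Real.pi * φ) : ℝ) : ℂ) *
        (Complex.cos ((Real.pi * φ - Real.pi / 2 : ℝ) : ℂ) +
          Complex.sin ((Real.pi * φ - Real.pi / 2 : ℝ) : ℂ) * Complex.I) := by
    rw [e1, Complex.exp_mul_I, ← Complex.ofReal_cos, ← Complex.ofReal_sin, ← Complex.ofReal_cos,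
      ← Complex.ofReal_sin, Real.cos_sub_pi_div_two, Real.sin_sub_pi_div_two, Real.cos_two_mul,
      Real.sin_two_mul, Real.cos_sq']
    push_cast
    ring
  rw [e2, Complex.arg_mul_cos_add_sin_mul_I (by positivity)
    ⟨by nlinarith [Real.pi_pos], by nlinarith [Real.pi_pos]⟩, sawtooth, if_neg hy]
  ring

theorem conj_pow_of_isPrimitiveRoot {ζ : ℂ} {n : ℕ} (hζ : IsPrimitiveRoot ζ (n + 1)) {j : ℕ}
    (hj : j ∈ Finset.range n) : conj (ζ ^ (j + 1)) = ζ ^ (n - 1 - j + 1) := by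
  have hn : ‖ζ ^ (j + 1)‖ = 1 := by rw [norm_pow, hζ.norm'_eq_one n.succ_ne_zero, one_pow]
  have hj' := Finset.mem_range.1 hj
  rw [← Complex.inv_eq_conj hn]
  refine inv_eq_of_mul_eq_one_right ?_
  rw [← pow_add, show j + 1 + (n - 1 - j + 1) = n + 1 by omega, hζ.pow_eq_one]

theorem pow_succ_ne_one_of_mem_range {ζ : ℂ} {n : ℕ} (hζ : IsPrimitiveRoot ζ (n + 1)) {j : ℕ}
    (hj : j ∈ Finset.range n) : ζ ^ (j + 1) ≠ 1 :=
  hζ.pow_ne_one_of_pos_of_lt j.succ_ne_zero (by simpa using Finset.mem_range.1 hj)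

theorem norm_pow_eq_one_of_isPrimitiveRoot {ζ : ℂ} {n : ℕ} (hζ : IsPrimitiveRoot ζ (n + 1))
    (j : ℕ) : ‖ζ ^ j‖ = 1 := by
  rw [norm_pow, hζ.norm'_eq_one n.succ_ne_zero, one_pow]

/-- Exponentiating gives ∏(1 - ζ^j) = n + 1, which fixes the sum only modulo 2πi. Complex
conjugation permutes the terms, so the sum is real and the ambiguity disappears. -/
theorem sum_log_one_sub_pow {ζ : ℂ} {n : ℕ} (hζ : IsPrimitiveRoot ζ (n + 1)) :
    ∑ j ∈ Finset.range n, Complex.log (1 - ζ ^ (j + 1)) = Real.log (n + 1) := by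
  set S := ∑ j ∈ Finset.range n, Complex.log (1 - ζ ^ (j + 1)) with hS
  have hslit := fun j (hj : j ∈ Finset.range n) =>
    one_sub_mem_slitPlane_of_norm_eq_one (norm_pow_eq_one_of_isPrimitiveRoot hζ (j + 1))
      (pow_succ_ne_one_of_mem_range hζ hj)
  have hconj : conj S = S := by
    rw [hS, map_sum, ← Finset.sum_range_reflect (fun j => Complex.log (1 - ζ ^ (j + 1)))]
    refine Finset.sum_congr rfl fun j hj => ?_
    rw [← Complex.log_conj _ (Complex.mem_slitPlane_iff_arg.1 (hslit j hj)).1, map_sub, map_one,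
      conj_pow_of_isPrimitiveRoot hζ hj]
  have hre : ((S.re : ℝ) : ℂ) = S := Complex.conj_eq_iff_re.1 hconj
  have hexp : Complex.exp S = (n : ℂ) + 1 := by
    rw [hS, Complex.exp_sum, ← hζ.prod_one_sub_pow_eq_order]
    exact Finset.prod_congr rfl fun j hj => Complex.exp_log (Complex.slitPlane_ne_zero (hslit j hj))
  have hexp' : Real.exp S.re = n + 1 := by
    rw [← hre] at hexp
    exact_mod_cast hexp
  rw [← hre, ← hexp', Real.log_exp]

theorem sum_mul_eq_zero_of_reflect {n : ℕ} {a : ℕ → ℝ}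
    (ha : ∀ j ∈ Finset.range n, a (n - 1 - j) = a j) :
    ∑ j ∈ Finset.range n, (1 / 2 - ((j : ℝ) + 1) / (n + 1)) * a j = 0 := by
  have h := Finset.sum_range_reflect (fun j : ℕ => (1 / 2 - ((j : ℝ) + 1) / (n + 1)) * a j) n
  have h2 : ∑ j ∈ Finset.range n, (1 / 2 - (((n - 1 - j : ℕ) : ℝ) + 1) / (n + 1)) * a (n - 1 - j) =
      -∑ j ∈ Finset.range n, (1 / 2 - ((j : ℝ) + 1) / (n + 1)) * a j := by
    rw [← Finset.sum_neg_distrib]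
    refine Finset.sum_congr rfl fun j hj => ?_
    have hj' := Finset.mem_range.1 hj
    have e : ((n - 1 - j : ℕ) : ℝ) = n - 1 - j := by
      rw [Nat.cast_sub (by omega), Nat.cast_sub (by omega), Nat.cast_one]
    rw [ha j hj, e]
    field_simp
    ring
  linarith

theorem fract_div_ne_zero {M : ℤ} {n : ℕ} (hM : IsCoprime M ((n + 1 : ℕ) : ℤ)) {j : ℕ}
    (hj : j ∈ Finset.range n) : Int.fract ((M : ℝ) * (j + 1 : ℕ) / (n + 1 : ℕ)) ≠ 0 := by
  intro h
  obtain ⟨z, hz⟩ := Int.fract_eq_zero_iff.1 h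
  rw [eq_div_iff (by positivity)] at hz
  have h1 : M * (j + 1 : ℕ) = ((n + 1 : ℕ) : ℤ) * z := by
    have : (M : ℝ) * (j + 1 : ℕ) = (n + 1 : ℕ) * z := by rw [← hz]; ring
    exact_mod_cast this
  have h2 : ((n + 1 : ℕ) : ℤ) ∣ ((j + 1 : ℕ) : ℤ) := hM.symm.dvd_of_dvd_mul_left ⟨z, h1⟩
  have h3 := Nat.le_of_dvd j.succ_pos (Int.natCast_dvd_natCast.1 h2)
  have := Finset.mem_range.1 hj
  omega

/-- Dedekind sums as weighted sums of the logarithms of `1 - ζ^j`. -/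
theorem sum_mul_log_one_sub_pow {M : ℤ} {n : ℕ} (hM : IsCoprime M ((n + 1 : ℕ) : ℤ)) {ζ : ℂ}
    (hζ : ζ = Complex.exp (2 * Real.pi * Complex.I * (M / ((n + 1 : ℕ) : ℂ)))) :
    ∑ j ∈ Finset.range n, (1 / 2 - ((j : ℂ) + 1) / (n + 1)) * Complex.log (1 - ζ ^ (j + 1)) =
      -(Real.pi * Complex.I * dedekindSum M (n + 1)) := by
  have hprim : IsPrimitiveRoot ζ (n + 1) := by
    rw [hζ]
    exact Complex.isPrimitiveRoot_exp_of_isCoprime M (n + 1) n.succ_ne_zero hM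
  have hlog : ∀ j ∈ Finset.range n, Complex.log (1 - ζ ^ (j + 1)) =
      (Real.log ‖1 - ζ ^ (j + 1)‖ : ℝ) +
        ((Real.pi * sawtooth ((M : ℝ) * (j + 1 : ℕ) / (n + 1 : ℕ)) : ℝ) : ℂ) * Complex.I := by
    intro j hj
    rw [Complex.log, ← arg_one_sub_exp (fract_div_ne_zero hM hj), hζ, ← Complex.exp_nat_mul]
    congr 6
    push_cast
    ring
  -- The moduli are symmetric under j ↦ N - j and the weights antisymmetric, so only the arguments
  -- survive.
  have hre := sum_mul_eq_zero_of_reflect (n := n) (a := fun j => Real.log ‖1 - ζ ^ (j + 1)‖)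
    fun j hj => by
      rw [← conj_pow_of_isPrimitiveRoot hprim hj, ← Complex.norm_conj (1 - ζ ^ (j + 1)), map_sub,
        map_one]
  have him : dedekindSum M (n + 1) = -∑ j ∈ Finset.range n, (1 / 2 - ((j : ℝ) + 1) / (n + 1)) *
      sawtooth ((M : ℝ) * (j + 1 : ℕ) / (n + 1 : ℕ)) := by
    rw [dedekindSum, Finset.sum_range_succ', ← Finset.sum_neg_distrib]
    simp only [Nat.cast_zero, zero_div, mul_zero]
    rw [show sawtooth 0 = 0 by simp [sawtooth], zero_mul, add_zero]
    refine Finset.sum_congr rfl fun j hj => ?_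
    have hj' : (j : ℝ) < n := by exact_mod_cast Finset.mem_range.1 hj
    have hfr : Int.fract (((j + 1 : ℕ) : ℝ) / (n + 1 : ℕ)) = ((j : ℝ) + 1) / (n + 1) := by
      push_cast
      refine Int.fract_eq_self.2 ⟨by positivity, ?_⟩
      rw [div_lt_one (by positivity)]
      linarith
    have hsaw : sawtooth (((j + 1 : ℕ) : ℝ) / (n + 1 : ℕ)) = ((j : ℝ) + 1) / (n + 1) - 1 / 2 := by
      rw [sawtooth, hfr, if_neg (by positivity)]
    rw [hsaw]
    ring
  have hre' : ∑ j ∈ Finset.range n, (1 / 2 - ((j : ℂ) + 1) / (n + 1)) *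
      ((Real.log ‖1 - ζ ^ (j + 1)‖ : ℝ) : ℂ) = 0 := by
    rw [← Complex.ofReal_zero, ← hre, Complex.ofReal_sum]
    refine Finset.sum_congr rfl fun j _ => ?_
    rw [Complex.ofReal_mul]
    push_cast
    rfl
  rw [Finset.sum_congr rfl fun j hj => by rw [hlog j hj, mul_add], Finset.sum_add_distrib, hre',
    zero_add, him]
  push_cast
  rw [mul_neg, neg_neg, Finset.mul_sum]
  refine Finset.sum_congr rfl fun j _ => ?_
  ring

/-! ### λ as a greatest common divisor -/

/-- Write k = k'g and t = t'g with g = gcd(k, t). If b ∤ k', only g cancels. If k' = bm, then gb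
cancels and leaves ht' + am over mb; the numerator is prime to m, so one further b cancels exactly
when b divides it. -/
theorem lam_eq_gcd {t b h k : ℕ} {a : ℤ} (hb : b.Prime) (hba : ¬ (b : ℤ) ∣ a) (ht : 0 < t)
    (hk : 0 < k) (hhk : Nat.Coprime h k) :
    lam t a b h k = Int.gcd ((h : ℤ) * b * t + a * k) (k * b) := by
  obtain ⟨g, k', t', hg, hkt, rfl, rfl⟩ := Nat.exists_coprime' (m := k) (n := t)
    (Nat.gcd_pos_of_pos_left t hk)
  have hk' : 0 < k' := Nat.pos_of_mul_pos_right hk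
  have hgcd : Nat.gcd (k' * g) (t' * g) = g := by
    rw [Nat.gcd_mul_right, hkt.gcd_eq_one, one_mul]
  have hbp : Prime (b : ℤ) := Nat.prime_iff_prime_int.1 hb
  have hhk' : IsCoprime (h : ℤ) k' := (hhk.coprime_mul_right_right).isCoprime
  have hht : IsCoprime ((h : ℤ) * t') k' := hhk'.mul_left hkt.symm.isCoprime
  rw [lam, hgcd, Nat.mul_div_cancel _ hg, Nat.mul_div_cancel _ hg]
  by_cases hbk : b ∣ k'
  · obtain ⟨m, rfl⟩ := hbk
    have hk1 : b * m * g ≠ 1 := fun h1 =>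
      hb.one_lt.ne' (Nat.eq_one_of_mul_eq_one_right (Nat.eq_one_of_mul_eq_one_right h1))
    rw [if_neg (by simp [hk1]), show b * m * g / (b * g) = m by
      rw [show b * m * g = b * g * m by ring]
      exact Nat.mul_div_cancel_left _ (Nat.mul_pos hb.pos hg)]
    have hcop : IsCoprime ((h : ℤ) * t' + a * m) m := by
      refine IsCoprime.add_mul_right_left ?_ a
      push_cast at hht
      exact hht.of_mul_right_right
    have e1 : (h : ℤ) * b * ((t' * g : ℕ) : ℤ) + a * ((b * m * g : ℕ) : ℤ) =
        ((g * b : ℕ) : ℤ) * ((h : ℤ) * t' + a * m) := by push_cast; ring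
    have e2 : ((b * m * g : ℕ) : ℤ) * b = ((g * b : ℕ) : ℤ) * (m * b) := by push_cast; ring
    rw [e1, e2, Int.gcd_mul_left, Int.natAbs_natCast]
    split_ifs with hX
    · have hX' : (b : ℤ) ∣ (h : ℤ) * t' + a * m := (Int.modEq_zero_iff_dvd).1 (by simpa using hX)
      obtain ⟨Y, hY⟩ := hX'
      rw [hY, mul_comm (m : ℤ), Int.gcd_mul_left, Int.natAbs_natCast]
      rw [hY] at hcop
      rw [Int.isCoprime_iff_gcd_eq_one.1 hcop.of_mul_left_right]
      ring
    · have hX' : ¬ (b : ℤ) ∣ (h : ℤ) * t' + a * m := fun hd =>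
        hX ((Int.modEq_zero_iff_dvd).2 hd)
      have hcop2 := hcop.mul_right ((hbp.coprime_iff_not_dvd).2 hX').symm
      rw [Int.isCoprime_iff_gcd_eq_one.1 hcop2, mul_one]
  · have hcond : k' * g = 1 ∨ (1 < k' * g ∧ ¬ b ∣ k') := by
      rcases Nat.lt_or_ge 1 (k' * g) with h1 | h1
      · exact Or.inr ⟨h1, hbk⟩
      · exact Or.inl (by omega)
    rw [if_pos hcond, mul_one]
    have hbk' : IsCoprime (b : ℤ) k' := ((Nat.Prime.coprime_iff_not_dvd hb).2 hbk).isCoprime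
    have hba' : IsCoprime (b : ℤ) a := (hbp.coprime_iff_not_dvd).2 hba
    have e1 : (h : ℤ) * b * ((t' * g : ℕ) : ℤ) + a * ((k' * g : ℕ) : ℤ) =
        (g : ℤ) * ((h : ℤ) * t' * b + a * k') := by push_cast; ring
    have e2 : ((k' * g : ℕ) : ℤ) * b = (g : ℤ) * (k' * b) := by push_cast; ring
    have h1 : IsCoprime ((h : ℤ) * t' * b + a * k') k' :=
      IsCoprime.add_mul_right_left (hht.mul_left hbk') a
    have h2 : IsCoprime ((h : ℤ) * t' * b + a * k') b := by
      rw [add_comm]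
      exact IsCoprime.add_mul_right_left (hba'.mul_right hbk').symm _
    rw [e1, e2, Int.gcd_mul_left, Int.natAbs_natCast,
      Int.isCoprime_iff_gcd_eq_one.1 (h1.mul_right h2), mul_one]

/-! ### The three asymptotic formulas -/

section Asymptotics

variable {θ : ℝ}

theorem dilog_eq_lerchPhi (ξ : ℂ) : ξ * lerchPhi ξ 2 1 = dilog ξ := by
  rw [lerchPhi, dilog, ← tsum_mul_left]
  refine tsum_congr fun n => ?_
  have h2 : ((n : ℂ) + 1) ^ (2 : ℂ) = ((n : ℂ) + 1) ^ 2 := by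
    exact_mod_cast Complex.cpow_natCast ((n : ℂ) + 1) 2
  rw [h2]
  ring

theorem norm_exp_neg_lt_one {z : ℂ} (hz : 0 < z.re) : ‖Complex.exp (-z)‖ < 1 := by
  rw [Complex.norm_exp, Complex.neg_re, Real.exp_lt_one_iff]
  linarith

theorem F1_eq_expProd (ξ z : ℂ) : F1 ξ (Complex.exp (-z)) = expProd ξ 1 z := by
  rw [F1, expProd]
  refine tprod_congr fun n => ?_
  rw [← Complex.exp_nat_mul]
  congr 3
  push_cast
  ring

theorem F1_asymptotic (hθ0 : 0 ≤ θ) (hθ : θ < Real.pi / 2) {ξ : ℂ} (hξ : ‖ξ‖ = 1)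
    (hξ1 : ξ ≠ 1) :
    EqOneAddBigO (toZeroIn θ) (fun z => F1 ξ (Complex.exp (-z)))
      fun z => 1 / (1 - ξ) ^ (1 / 2 : ℂ) * Complex.exp (-(ξ * lerchPhi ξ 2 1) / z) := by
  refine (eqOneAddBigO_expProd hθ0 hθ hξ hξ1 zero_lt_one le_rfl).congr'
    (Eventually.of_forall fun z => (F1_eq_expProd ξ z).symm) (Eventually.of_forall fun z => ?_)
  have h0 : 1 - ξ ≠ 0 := sub_ne_zero.2 hξ1.symm
  simp only
  rw [dilog_eq_lerchPhi, Complex.cpow_def_of_ne_zero h0, one_div (Complex.exp _), ← Complex.exp_neg,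
    ← Complex.exp_add]
  congr 1
  push_cast
  ring

/-- Since ξ⁻¹(ξq)^{k+1} = ξ^k q^{k+1}, the class with coefficient 1 comes first, at x = 1/(n+1);
this is the source of Γ(1/b). -/
theorem F3_eq_prod {ξ : ℂ} {n : ℕ} (hξ : IsPrimitiveRoot ξ (n + 1)) {z : ℂ} (hz : 0 < z.re) :
    F3 ξ (Complex.exp (-z)) = (∏ j ∈ Finset.range n, expProd (ξ ^ (j + 1))
      (((j : ℝ) + 2) / (n + 1)) (((n + 1 : ℝ) : ℂ) * z)) *
        expProd 1 (1 / (n + 1)) (((n + 1 : ℝ) : ℂ) * z) := by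
  have hξ0 : ξ ≠ 0 := hξ.ne_zero n.succ_ne_zero
  have hn : ‖ξ‖ = 1 := hξ.norm'_eq_one n.succ_ne_zero
  have hterm : ∀ k : ℕ, 1 - ξ⁻¹ * (ξ * Complex.exp (-z)) ^ (k + 1) =
      1 - ξ ^ k * Complex.exp (-(((k : ℂ) + 1) * z)) := fun k => by
    rw [mul_pow, ← Complex.exp_nat_mul, pow_succ, ← mul_assoc, mul_comm (ξ ^ k), ← mul_assoc,
      inv_mul_cancel₀ hξ0, one_mul]
    congr 3
    push_cast
    ring
  have hm := (multipliable_one_sub_mul_pow ξ⁻¹ (ξ * Complex.exp (-z)) (by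
    rw [norm_mul, hn, one_mul]
    exact norm_exp_neg_lt_one hz)).congr hterm
  rw [F3, tprod_congr hterm, tprod_eq_prod_expProd n.succ_pos (fun m j => by
    rw [pow_add, pow_mul, hξ.pow_eq_one, one_pow, one_mul]) hz hm, Finset.prod_range_succ']
  push_cast
  simp only [pow_zero, zero_add]
  congr 1
  refine Finset.prod_congr rfl fun j _ => ?_
  congr 2
  ring

theorem F3_asymptotic (hθ0 : 0 ≤ θ) (hθ : θ < Real.pi / 2) {ξ : ℂ} {n : ℕ}
    (hξ : IsPrimitiveRoot ξ (n + 1)) :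
    EqOneAddBigO (toZeroIn θ) (fun z => F3 ξ (Complex.exp (-z)))
      fun z => (Real.sqrt (2 * Real.pi) : ℂ) *
          (((n + 1 : ℕ) : ℂ) ^ 2 * z) ^ (1 / 2 - 1 / ((n + 1 : ℕ) : ℂ)) /
            (Real.Gamma (1 / ((n + 1 : ℕ) : ℝ)) : ℂ) *
          (∏ j ∈ Finset.Icc 1 (n + 1 - 1), 1 / (1 - ξ ^ j) ^ ((j : ℂ) / ((n + 1 : ℕ) : ℂ))) *
          Complex.exp (-(Real.pi : ℂ) ^ 2 / (6 * ((n + 1 : ℕ) : ℂ) ^ 2 * z)) := by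
  have hpos : (0 : ℝ) < (n : ℝ) + 1 := by positivity
  have hfac := ((EqOneAddBigO.prod (toZeroIn_le θ) (Finset.range n) fun j hj =>
    (eqOneAddBigO_expProd hθ0 hθ (norm_pow_eq_one_of_isPrimitiveRoot hξ (j + 1))
      (pow_succ_ne_one_of_mem_range hξ hj) (x := ((j : ℝ) + 2) / (n + 1)) (by positivity) (by
        have : (j : ℝ) + 1 ≤ n := by exact_mod_cast Finset.mem_range.1 hj
        rw [div_le_one hpos]
        linarith)).comp_mul hpos).mul (toZeroIn_le θ)
    ((eqOneAddBigO_expProd_one hθ0 hθ (x := 1 / ((n : ℝ) + 1)) (by positivity) (by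
        rw [div_le_one hpos]
        linarith [Nat.cast_nonneg (α := ℝ) n])).comp_mul hpos))
  refine hfac.congr' ?_ ?_
  · filter_upwards [eventually_re_pos hθ0 hθ] with z hz
    exact (F3_eq_prod hξ hz).symm
  · filter_upwards [eventually_re_pos hθ0 hθ] with z hz
    have hz0 : z ≠ 0 := by rintro rfl; simp at hz
    have hN0 : (n : ℂ) + 1 ≠ 0 := Nat.cast_add_one_ne_zero n
    have hd := sum_dilog_pow n.succ_pos hξ
    rw [Finset.sum_range_succ', pow_zero, dilog_one] at hd
    have hl := sum_log_one_sub_pow hξ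
    have hprod : ∏ j ∈ Finset.Icc 1 (n + 1 - 1),
        1 / (1 - ξ ^ j) ^ ((j : ℂ) / ((n + 1 : ℕ) : ℂ)) =
        Complex.exp (-∑ j ∈ Finset.range n,
          ((j : ℂ) + 1) / (n + 1) * Complex.log (1 - ξ ^ (j + 1))) := by
      rw [Nat.add_sub_cancel, ← Finset.sum_neg_distrib, Complex.exp_sum,
        ← Finset.Ico_add_one_right_eq_Icc, Finset.prod_Ico_eq_prod_range, Nat.add_sub_cancel]
      refine Finset.prod_congr rfl fun j hj => ?_
      rw [add_comm 1 j, Complex.cpow_def_of_ne_zero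
        (sub_ne_zero.2 (pow_succ_ne_one_of_mem_range hξ hj).symm), one_div, ← Complex.exp_neg]
      congr 2
      push_cast
      ring
    have hNz : ((n + 1 : ℝ) : ℂ) * z ≠ 0 := mul_ne_zero (Complex.ofReal_ne_zero.2 hpos.ne') hz0
    -- One factor of b² matches the sum of the log(1 - ξ^j), the other the rescaling w = bz.
    have hpow : (((n + 1 : ℕ) : ℂ) ^ 2 * z) ^ (1 / 2 - 1 / ((n + 1 : ℕ) : ℂ)) =
        Complex.exp ((Real.log (n + 1) + Complex.log (((n + 1 : ℝ) : ℂ) * z)) *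
          (1 / 2 - 1 / (n + 1))) := by
      have e : ((n + 1 : ℕ) : ℂ) ^ 2 * z = ((n + 1 : ℝ) : ℂ) * (((n + 1 : ℝ) : ℂ) * z) := by
        push_cast
        ring
      rw [e, Complex.cpow_def_of_ne_zero (mul_ne_zero (Complex.ofReal_ne_zero.2 hpos.ne') hNz),
        Complex.log_ofReal_mul hpos hNz]
      push_cast
      rfl
    -- Here 1/2 - (j+2)/N splits as (1/2 - 1/N) - (j+1)/N: the first part multiplies log N, the
    -- second yields the product over j.
    have hsum : ∑ j ∈ Finset.range n, (-(dilog (ξ ^ (j + 1)) / (((n + 1 : ℝ) : ℂ) * z)) +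
        (1 / 2 - ((((j : ℝ) + 2) / (n + 1) : ℝ) : ℂ)) * Complex.log (1 - ξ ^ (j + 1))) =
        -((Real.pi ^ 2 / 6 / ((n + 1 : ℕ) : ℂ) - Real.pi ^ 2 / 6) / (((n + 1 : ℝ) : ℂ) * z)) +
        (1 / 2 - 1 / (n + 1)) * Real.log (n + 1) -
          ∑ j ∈ Finset.range n, ((j : ℂ) + 1) / (n + 1) * Complex.log (1 - ξ ^ (j + 1)) := by
      rw [← hd, add_sub_cancel_right, ← hl, Finset.mul_sum, Finset.sum_div,
        ← Finset.sum_neg_distrib, ← Finset.sum_add_distrib, ← Finset.sum_sub_distrib]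
      refine Finset.sum_congr rfl fun j _ => ?_
      push_cast
      ring
    have hG : ((1 / (n + 1 : ℝ) : ℝ)) = 1 / ((n + 1 : ℕ) : ℝ) := by push_cast; rfl
    rw [hprod, hpow, ← Complex.exp_sum, hsum, ← hG]
    have hassoc : ∀ A G p q r s t : ℂ, p * s = q * r * t → p * (A / G * s) = A * q / G * r * t := by
      intro A G p q r s t h
      linear_combination (A / G) * h
    refine hassoc _ _ _ _ _ _ _ ?_
    rw [← Complex.exp_add, ← Complex.exp_add, ← Complex.exp_add]
    congr 1
    push_cast
    field_simp
    ring

/-- The class with coefficient 1 now comes last, at x = 1, where Γ(x) = 1. In the others x = j/N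
accompanies ζ^j, which produces the Dedekind-sum weights. -/
theorem F2_eq_prod {ζ : ℂ} {n : ℕ} (hζ : IsPrimitiveRoot ζ (n + 1)) {w : ℂ} (hw : 0 < w.re) :
    F2 ζ (Complex.exp (-w)) = (∏ j ∈ Finset.range n, expProd (ζ ^ (j + 1))
      (((j : ℝ) + 1) / (n + 1)) (((n + 1 : ℝ) : ℂ) * w)) *
        expProd 1 1 (((n + 1 : ℝ) : ℂ) * w) := by
  have hn : ‖ζ‖ = 1 := hζ.norm'_eq_one n.succ_ne_zero
  have hterm : ∀ k : ℕ, 1 - 1 * (ζ * Complex.exp (-w)) ^ (k + 1) =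
      1 - ζ ^ (k + 1) * Complex.exp (-(((k : ℂ) + 1) * w)) := fun k => by
    rw [mul_pow, ← Complex.exp_nat_mul, one_mul]
    congr 3
    push_cast
    ring
  have hm := (multipliable_one_sub_mul_pow 1 (ζ * Complex.exp (-w)) (by
    rw [norm_mul, hn, one_mul]
    exact norm_exp_neg_lt_one hw)).congr hterm
  have hF2 : F2 ζ (Complex.exp (-w)) =
      ∏' k : ℕ, (1 - ζ ^ (k + 1) * Complex.exp (-(((k : ℂ) + 1) * w))) := by
    rw [F2]
    exact tprod_congr fun k => by rw [← hterm, one_mul]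
  rw [hF2,
    tprod_eq_prod_expProd (c := fun k => ζ ^ (k + 1)) n.succ_pos (fun m j => by
    rw [add_assoc, pow_add, pow_mul, hζ.pow_eq_one, one_pow, one_mul]) hw hm,
    Finset.prod_range_succ, hζ.pow_eq_one]
  push_cast
  rw [div_self (by positivity)]

theorem F2_asymptotic (hθ0 : 0 ≤ θ) (hθ : θ < Real.pi / 2) {M : ℤ} {n : ℕ}
    (hM : IsCoprime M ((n + 1 : ℕ) : ℤ)) {ζ : ℂ}
    (hζ : ζ = Complex.exp (2 * Real.pi * Complex.I * (M / ((n + 1 : ℕ) : ℂ)))) :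
    EqOneAddBigO (toZeroIn θ) (fun w => F2 ζ (Complex.exp (-w)))
      fun w => Complex.exp (-(Real.pi * Complex.I * dedekindSum M (n + 1))) *
        Real.sqrt (2 * Real.pi) * Complex.exp (-(Real.pi ^ 2 / 6 / ((n + 1 : ℕ) : ℂ) ^ 2 / w) -
          1 / 2 * Complex.log (((n + 1 : ℝ) : ℂ) * w)) := by
  have hpos : (0 : ℝ) < (n : ℝ) + 1 := by positivity
  have hprim : IsPrimitiveRoot ζ (n + 1) := by
    rw [hζ]
    exact Complex.isPrimitiveRoot_exp_of_isCoprime M (n + 1) n.succ_ne_zero hM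
  have hfac := ((EqOneAddBigO.prod (toZeroIn_le θ) (Finset.range n) fun j hj =>
    (eqOneAddBigO_expProd hθ0 hθ (norm_pow_eq_one_of_isPrimitiveRoot hprim (j + 1))
      (pow_succ_ne_one_of_mem_range hprim hj) (x := ((j : ℝ) + 1) / (n + 1)) (by positivity) (by
        have : (j : ℝ) + 1 ≤ n := by exact_mod_cast Finset.mem_range.1 hj
        rw [div_le_one hpos]
        linarith)).comp_mul hpos).mul (toZeroIn_le θ)
    ((eqOneAddBigO_expProd_one hθ0 hθ zero_lt_one le_rfl).comp_mul hpos))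
  refine hfac.congr' ?_ ?_
  · filter_upwards [eventually_re_pos hθ0 hθ] with z hz
    exact (F2_eq_prod hprim hz).symm
  · filter_upwards [eventually_re_pos hθ0 hθ] with z hz
    have hz0 : z ≠ 0 := by rintro rfl; simp at hz
    have hN0 : (n : ℂ) + 1 ≠ 0 := Nat.cast_add_one_ne_zero n
    have hd := sum_dilog_pow n.succ_pos hprim
    rw [Finset.sum_range_succ', pow_zero, dilog_one] at hd
    have hsum : ∑ j ∈ Finset.range n, (-(dilog (ζ ^ (j + 1)) / (((n + 1 : ℝ) : ℂ) * z)) +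
        (1 / 2 - ((((j : ℝ) + 1) / (n + 1) : ℝ) : ℂ)) * Complex.log (1 - ζ ^ (j + 1))) =
        -((Real.pi ^ 2 / 6 / ((n + 1 : ℕ) : ℂ) - Real.pi ^ 2 / 6) / (((n + 1 : ℝ) : ℂ) * z)) +
        -(Real.pi * Complex.I * dedekindSum M (n + 1)) := by
      rw [← hd, add_sub_cancel_right, ← sum_mul_log_one_sub_pow hM hζ, Finset.sum_div,
        ← Finset.sum_neg_distrib, ← Finset.sum_add_distrib]
      refine Finset.sum_congr rfl fun j _ => ?_
      push_cast
      ring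
    rw [← Complex.exp_sum, hsum, Real.Gamma_one]
    have hassoc : ∀ A p q s t : ℂ, p * s = q * t →
        p * (A / ((1 : ℝ) : ℂ) * s) = q * A * t := by
      intro A p q s t h
      push_cast
      linear_combination A * h
    refine hassoc _ _ _ _ _ ?_
    rw [← Complex.exp_add, ← Complex.exp_add]
    congr 1
    push_cast
    field_simp
    ring

/-- F₂ depends only on ξq^t = e^{2πi(a/b + ht/k)} e^{-2πtz/k}. In lowest terms a/b + ht/k is M/N
with λM = hbt + ak and λN = kb, so the asymptotics at a primitive N-th root apply with w = 2πtz/k.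
-/
theorem F2_root_of_unity_asymptotic (hθ0 : 0 ≤ θ) (hθ : θ < Real.pi / 2) {b : ℕ} (hb : b.Prime)
    {a : ℤ} (hba : ¬ (b : ℤ) ∣ a) {ξ : ℂ}
    (hξ : ξ = Complex.exp (2 * Real.pi * Complex.I * a / b)) {t h k : ℕ} (ht : 0 < t)
    (hk : 0 < k) (hhk : Nat.Coprime h k) :
    EqOneAddBigO (toZeroIn θ)
      (fun z => F2 ξ (Complex.exp (2 * Real.pi * Complex.I / k * (h + Complex.I * z)) ^ t))
      (fun z => (etaOmega (((h : ℤ) * b * t + a * k) / (lam t a b h k : ℤ))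
          (k * b / lam t a b h k))⁻¹ *
        ((lam t a b h k : ℂ) / (t * b * z)) ^ (1 / 2 : ℂ) *
        Complex.exp (-(Real.pi * (lam t a b h k : ℂ) ^ 2) / (12 * (b : ℂ) ^ 2 * k * t * z))) := by
  have hlam := lam_eq_gcd hb hba ht hk hhk
  set L := lam t a b h k with hL
  set A : ℤ := (h : ℤ) * b * t + a * k with hA
  have hkb : 0 < k * b := Nat.mul_pos hk hb.pos
  have hLpos : 0 < L := by
    rw [hlam]
    exact Int.gcd_pos_of_ne_zero_right _ (by exact_mod_cast hkb.ne')
  obtain ⟨M, hM⟩ : (L : ℤ) ∣ A := by rw [hlam]; exact Int.gcd_dvd_left ..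
  obtain ⟨N, hN⟩ : L ∣ k * b := by
    have : (L : ℤ) ∣ (k : ℤ) * b := by rw [hlam]; exact Int.gcd_dvd_right ..
    exact_mod_cast this
  have hNpos : 0 < N := Nat.pos_of_mul_pos_left (hN ▸ hkb)
  have hMdiv : A / (L : ℤ) = M := by
    rw [hM]
    exact Int.mul_ediv_cancel_left _ (by exact_mod_cast hLpos.ne')
  have hNdiv : k * b / L = N := by
    rw [hN]
    exact Nat.mul_div_cancel_left _ hLpos
  have hgcd : Int.gcd M N = 1 := by
    have e : (k : ℤ) * b = L * N := by exact_mod_cast hN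
    rw [hM, e, Int.gcd_mul_left, Int.natAbs_natCast] at hlam
    exact Nat.eq_of_mul_eq_mul_left hLpos (by rw [← hlam, mul_one])
  obtain ⟨n, rfl⟩ : ∃ n, N = n + 1 := ⟨N - 1, by omega⟩
  have hcop : IsCoprime M ((n + 1 : ℕ) : ℤ) := Int.isCoprime_iff_gcd_eq_one.2 hgcd
  have hLC : (L : ℂ) ≠ 0 := Nat.cast_ne_zero.2 hLpos.ne'
  have hkC : (k : ℂ) ≠ 0 := Nat.cast_ne_zero.2 hk.ne'
  have hbC : (b : ℂ) ≠ 0 := Nat.cast_ne_zero.2 hb.ne_zero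
  have htC : (t : ℂ) ≠ 0 := Nat.cast_ne_zero.2 ht.ne'
  have hMC : (h : ℂ) * b * t + a * k = L * M := by exact_mod_cast hM
  have hNC : (k : ℂ) * b = L * (n + 1) := by exact_mod_cast congrArg (Nat.cast (R := ℂ)) hN
  have hn0 : (n : ℂ) + 1 ≠ 0 := Nat.cast_add_one_ne_zero n
  have hc : (0 : ℝ) < 2 * Real.pi * t / k := by positivity
  refine ((F2_asymptotic hθ0 hθ hcop rfl).comp_mul hc).congr'
    (Eventually.of_forall fun z => ?_) ?_
  · have hq : Complex.exp (2 * Real.pi * Complex.I * (M / ((n + 1 : ℕ) : ℂ))) *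
        Complex.exp (-(((2 * Real.pi * t / k : ℝ) : ℂ) * z)) =
        ξ * Complex.exp (2 * Real.pi * Complex.I / k * (h + Complex.I * z)) ^ t := by
      have hMN : (M : ℂ) / ((n + 1 : ℕ) : ℂ) = h * t / k + a / b := by
        push_cast
        rw [div_add_div _ _ hkC hbC, hNC, div_eq_div_iff hn0 (mul_ne_zero hLC hn0)]
        linear_combination (-(n + 1) : ℂ) * hMC
      rw [hξ, ← Complex.exp_nat_mul, ← Complex.exp_add, ← Complex.exp_add, hMN]
      congr 1
      push_cast
      field_simp
      linear_combination (-(t * z * b) : ℂ) * Complex.I_sq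
    simp only [F2, hq]
  · filter_upwards [eventually_re_pos hθ0 hθ] with z hz
    have hz0 : z ≠ 0 := by rintro rfl; simp at hz
    set r : ℝ := t * b / L with hr
    have hrpos : 0 < r := by
      have := hb.pos
      positivity
    have hrz : 0 < ((r : ℂ) * z).re := by
      rw [Complex.re_ofReal_mul]
      positivity
    have hrz0 := Complex.slitPlane_ne_zero (Or.inl hrz)
    have hvinv : (L : ℂ) / (t * b * z) = ((r : ℂ) * z)⁻¹ := by
      rw [hr]
      push_cast
      field_simp
    have hpow : ((L : ℂ) / (t * b * z)) ^ (1 / 2 : ℂ) =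
        Complex.exp (-(1 / 2) * Complex.log ((r : ℂ) * z)) := by
      rw [hvinv, Complex.cpow_def_of_ne_zero (inv_ne_zero hrz0),
        Complex.log_inv _ (Complex.mem_slitPlane_iff_arg.1 (Or.inl hrz)).1]
      congr 1
      ring
    -- As Nλ = kb, the rescaled variable Nw is 2π·(tb/λ)z; its 2π cancels the factor √(2π).
    have hlog : Complex.log (((n + 1 : ℝ) : ℂ) * (((2 * Real.pi * t / k : ℝ) : ℂ) * z)) =
        Real.log (2 * Real.pi) + Complex.log ((r : ℂ) * z) := by
      rw [← Complex.log_ofReal_mul (by positivity) hrz0]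
      congr 1
      rw [hr]
      push_cast
      field_simp
      linear_combination -hNC
    have hsqrt : ((Real.sqrt (2 * Real.pi) : ℝ) : ℂ) =
        Complex.exp (1 / 2 * Real.log (2 * Real.pi)) := by
      rw [Real.sqrt_eq_rpow, Real.rpow_def_of_pos (by positivity)]
      push_cast
      congr 1
      ring
    have hω : etaOmega M (n + 1) = Complex.exp (Real.pi * Complex.I * dedekindSum M (n + 1)) := by
      rw [etaOmega, hgcd, Nat.div_one, Nat.cast_one, Int.ediv_one]
    rw [hMdiv, hNdiv, hω, hpow, hlog, hsqrt, ← Complex.exp_neg, ← Complex.exp_add,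
      ← Complex.exp_add, ← Complex.exp_add, ← Complex.exp_add]
    congr 1
    have e : (Real.pi : ℂ) ^ 2 / 6 / ((n + 1 : ℕ) : ℂ) ^ 2 / (((2 * Real.pi * t / k : ℝ) : ℂ) * z) =
        Real.pi * (L : ℂ) ^ 2 / (12 * (b : ℂ) ^ 2 * k * t * z) := by
      have : (n : ℂ) + 1 = k * b / L := by
        rw [hNC]
        field_simp
      push_cast
      rw [this]
      field_simp
      ring
    rw [e]
    ring

end Asymptotics

end QProducts

theorem theorem2p1 (b : ℕ) (hb : 0 < b) (ξ : ℂ) (hξ : IsPrimitiveRoot ξ b)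
    (θ : ℝ) (hθ0 : 0 ≤ θ) (hθ : θ < Real.pi / 2) :
    (b ≠ 1 →
      QProducts.EqOneAddBigO (QProducts.toZeroIn θ)
        (fun z => QProducts.F1 ξ (Complex.exp (-z)))
        (fun z => 1 / (1 - ξ) ^ (1 / 2 : ℂ) *
          Complex.exp (-(ξ * QProducts.lerchPhi ξ 2 1) / z))) ∧
    (b.Prime → Odd b →
      ∀ (a : ℤ) (t h k : ℕ), ξ = Complex.exp (2 * Real.pi * Complex.I * a / b) → 0 < t →
        h < k → Nat.Coprime h k →
        Asymptotics.IsEquivalent (QProducts.toZeroIn θ)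
          (fun z => QProducts.F2 ξ
            (Complex.exp (2 * Real.pi * Complex.I / k * (h + Complex.I * z)) ^ t))
          (fun z =>
            (QProducts.etaOmega
                (((h : ℤ) * b * t + a * k) / (QProducts.lam t a b h k : ℤ))
                (k * b / QProducts.lam t a b h k))⁻¹ *
              ((QProducts.lam t a b h k : ℂ) / (t * b * z)) ^ (1 / 2 : ℂ) *
              Complex.exp (-(Real.pi * (QProducts.lam t a b h k : ℂ) ^ 2) /
                (12 * (b : ℂ) ^ 2 * k * t * z)))) ∧
    QProducts.EqOneAddBigO (QProducts.toZeroIn θ)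
      (fun z => QProducts.F3 ξ (Complex.exp (-z)))
      (fun z =>
        (Real.sqrt (2 * Real.pi) : ℂ) * ((b : ℂ) ^ 2 * z) ^ (1 / 2 - 1 / (b : ℂ)) /
            (Real.Gamma (1 / (b : ℝ)) : ℂ) *
          (∏ j ∈ Finset.Icc 1 (b - 1), 1 / (1 - ξ ^ j) ^ ((j : ℂ) / (b : ℂ))) *
          Complex.exp (-(Real.pi : ℂ) ^ 2 / (6 * (b : ℂ) ^ 2 * z))) := by
  obtain ⟨n, rfl⟩ : ∃ n, b = n + 1 := ⟨b - 1, by omega⟩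
  refine ⟨fun hb1 => ?_, fun hbp _ a t h k hξa ht hhk hcop => ?_,
    QProducts.F3_asymptotic hθ0 hθ hξ⟩
  · exact QProducts.F1_asymptotic hθ0 hθ (hξ.norm'_eq_one n.succ_ne_zero) (hξ.ne_one (by omega))
  · refine (QProducts.F2_root_of_unity_asymptotic hθ0 hθ hbp (fun hdvd => ?_) hξa ht
      (Nat.zero_lt_of_lt hhk) hcop).isEquivalent (QProducts.toZeroIn_le θ)
    -- If b ∣ a then ξ = 1, which is not a primitive root of prime order.
    obtain ⟨m, rfl⟩ := hdvd
    refine hξ.ne_one hbp.one_lt ?_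
    rw [hξa, Complex.exp_eq_one_iff]
    refine ⟨m, ?_⟩
    have : (n : ℂ) + 1 ≠ 0 := Nat.cast_add_one_ne_zero n
    push_cast
    field_simp
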